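/- Let $M$ be a smooth, finite-dimensional, Hausdorff, second countable manifold and $\Theta\in\Omega^n(M)$ a smooth $n$-form. For an integer $p$ let $\mathfrak X^p(M)=\Gamma(\bigwedge^p TM)$, with $\mathfrak X^p(M)=0$ for $p<0$ and $\Omega^a(M)=0$ for $a<0$; let $\iota_{X_1\wedge\cdots\wedge X_p}\Theta=\Theta(X_1,\dots,X_p,\cdot)$; let $[\cdot,\cdot]$ be the Schouten–Nijenhuis bracket, the graded skew-symmetric bracket that extends the Lie bracket of vector fields and the action $[X,f]=X(f)$ of vector fields on functions and satisfies $[X,Y\wedge Z]=[X,Y]\wedge Z+(-1)^{(p-1)q}\,Y\wedge[X,Z]$ for $X\in\mathfrak X^p(M)$, $Y\in\mathfrak X^q(M)$; and let $\mathscr L_X=\mathrm d\,\iota_X-(-1)^p\iota_X\,\mathrm d$ for $X\in\mathfrak X^p(M)$. A multivector field $X\in\mathfrak X^p(M)$ is an infinitesimal conformal transformation of $\Theta$ if $\mathscr L_X\Theta=\iota_V\Theta$ for some $V\in\mathfrak X^{p-1}(M)$. A form $\alpha\in\Omega^{n-p}(M)$ is conformal Hamiltonian if $\iota_{X_\alpha}\Theta=-\alpha$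 for some infinitesimal conformal transformation $X_\alpha\in\mathfrak X^p(M)$ of $\Theta$. The graded Jacobi bracket of conformal Hamiltonian forms $\alpha,\beta$ is $\{\alpha,\beta\}=-\iota_{[X_\alpha,X_\beta]}\Theta$. Let $\alpha\in\Omega^{n-p}(M)$, $\beta\in\Omega^{n-q}(M)$ and $\gamma\in\Omega^{n-r}(M)$ be conformal Hamiltonian forms, where $p,q,r$ are integers. Then $\{\alpha,\beta\}$ does not depend on the choice of $X_\alpha$ and $X_\beta$, it is a conformal Hamiltonian form in $\Omega^{n-(p+q-1)}(M)$, and (i) $\{\alpha,\beta\}=-(-1)^{(p-1)(q-1)}\{\beta,\alpha\}$; (ii) $(-1)^{(p-1)(r-1)}\{\alpha,\{\beta,\gamma\}\}+(-1)^{(r-1)(q-1)}\{\gamma,\{\alpha,\beta\}\}+(-1)^{(q-1)(p-1)}\{\beta,\{\gamma,\alpha\}\}=0$. -/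

import Mathlib

open scoped Manifold ContDiff

noncomputable section

namespace GradedJacobi

/-! ### Exterior forms on a vector space and contraction with multivectors -/

section Algebra

variable (V : Type*) [AddCommGroup V] [Module ℝ V] [TopologicalSpace V]

/-- Exterior forms on `V`, not necessarily homogeneous: `η a` is the component of degree `a`. -/
abbrev Forms : Type _ := (a : ℕ) → V [⋀^Fin a]→L[ℝ] ℝ

variable {V}

/-- `(ι_v η)(v₁, …, v_a) = η(v, v₁, …, v_a)`. -/
def contractVec {a : ℕ} (v : V) (η : V [⋀^Fin (a + 1)]→L[ℝ] ℝ) : V [⋀^Fin a]→L[ℝ] ℝ :=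
  { η.toAlternatingMap.curryLeft v with
    cont := by
      change Continuous fun m : Fin a → V => η (Matrix.vecCons v m)
      exact η.cont.comp (continuous_const.matrixVecCons continuous_id) }

theorem contractVec_apply {a : ℕ} (v : V) (η : V [⋀^Fin (a + 1)]→L[ℝ] ℝ) (m : Fin a → V) :
    contractVec v η m = η (Matrix.vecCons v m) := rfl

/-- The operator `ι_v` on all forms, linear in the vector `v`. -/
def iotaVec : V →ₗ[ℝ] Module.End ℝ (Forms V) where
  toFun v :=
    { toFun := fun η a => contractVec v (η (a + 1))
      map_add' := fun _ _ => rfl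
      map_smul' := fun _ _ => rfl }
  map_add' v w := by
    refine LinearMap.ext fun η => funext fun a => ContinuousAlternatingMap.ext fun m => ?_
    exact (η (a + 1)).toAlternatingMap.map_vecCons_add m v w
  map_smul' c v := by
    refine LinearMap.ext fun η => funext fun a => ContinuousAlternatingMap.ext fun m => ?_
    exact (η (a + 1)).toAlternatingMap.map_vecCons_smul m c v

theorem iotaVec_mul_self (v : V) : iotaVec v * iotaVec v = 0 := by
  refine LinearMap.ext fun η => funext fun a => ContinuousAlternatingMap.ext fun m => ?_
  exact (η (a + 2)).map_eq_zero_of_eq (Matrix.vecCons v (Matrix.vecCons v m))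
    (i := 0) (j := 1) rfl (by simp)

/-- Contraction of forms with multivectors, as the algebra anti-homomorphism that extends
`v ↦ ι_v`; thus `ι_{u ∧ w} = ι_w ∘ ι_u`. -/
def contractHom : ExteriorAlgebra ℝ V →ₐ[ℝ] (Module.End ℝ (Forms V))ᵐᵒᵖ :=
  ExteriorAlgebra.lift ℝ
    ⟨(MulOpposite.opLinearEquiv ℝ).toLinearMap ∘ₗ iotaVec, fun v => by
      simp [← MulOpposite.op_mul, iotaVec_mul_self]⟩

/-- The interior product `ι_u η` of a form with a multivector; for `u = v₁ ∧ ⋯ ∧ v_p` it is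
`η(v₁, …, v_p, ·)`. -/
def interiorProd (u : ExteriorAlgebra ℝ V) (η : Forms V) : Forms V :=
  (contractHom u).unop η

/-- The `p`-vectors, for an integer degree `p`: `⋀^p V` for `p ≥ 0`, and `0` for `p < 0`. -/
def multivectors (V : Type*) [AddCommGroup V] [Module ℝ V] :
    ℤ → Submodule ℝ (ExteriorAlgebra ℝ V)
  | Int.ofNat k => ⋀[ℝ]^k V
  | Int.negSucc _ => ⊥

end Algebra

/-! ### Calculus in a vector space -/

section Local

variable {E : Type*} [NormedAddCommGroup E] [NormedSpace ℝ E] [FiniteDimensional ℝ E]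

instance finiteExteriorAlgebra : Module.Finite ℝ (ExteriorAlgebra ℝ E) :=
  Module.Finite.of_basis (Module.finBasis ℝ E).ExteriorAlgebra

/-- The exterior algebra of a finite-dimensional space is finite-dimensional; we fix a norm on it
(all norms are equivalent) in order to differentiate functions with values in it. -/
instance normedExteriorAlgebra : NormedAddCommGroup (ExteriorAlgebra ℝ E) :=
  NormedAddCommGroup.induced (ExteriorAlgebra ℝ E) _
    (Module.finBasis ℝ (ExteriorAlgebra ℝ E)).equivFun.toLinearMap
    (Module.finBasis ℝ (ExteriorAlgebra ℝ E)).equivFun.injective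

instance normedSpaceExteriorAlgebra : NormedSpace ℝ (ExteriorAlgebra ℝ E) :=
  NormedSpace.induced ℝ (ExteriorAlgebra ℝ E) _
    (Module.finBasis ℝ (ExteriorAlgebra ℝ E)).equivFun.toLinearMap

/-- The Schouten–Nijenhuis bracket on a vector space, of a field `X` of `p`-vectors with a
multivector field `Y`, in linear coordinates:
`[X, Y] = (-1)^(p-1) ∑ᵢ (ι_{dxⁱ} X) ∧ ∂ᵢY - ∑ᵢ ∂ᵢX ∧ (ι_{dxⁱ} Y)`,
where `ι_{dxⁱ}` contracts the first slot. It extends the Lie bracket of vector fields and satisfies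
`[X, Y ∧ Z] = [X, Y] ∧ Z + (-1)^((p-1)q) Y ∧ [X, Z]` for `Y` of degree `q`. -/
def schoutenLocal (p : ℤ) (X Y : E → ExteriorAlgebra ℝ E) (y : E) : ExteriorAlgebra ℝ E :=
  (-1 : ℝ) ^ (p - 1) • (∑ i, CliffordAlgebra.contractLeft ((Module.finBasis ℝ E).coord i) (X y) *
      fderiv ℝ Y y (Module.finBasis ℝ E i)) -
    ∑ i, fderiv ℝ X y (Module.finBasis ℝ E i) *
      CliffordAlgebra.contractLeft ((Module.finBasis ℝ E).coord i) (Y y)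

/-- The exterior derivative on a vector space, in all degrees. -/
def extDerivLocal (η : E → Forms E) (y : E) : Forms E
  | 0 => 0
  | a + 1 => extDeriv (fun z => η z a) y

end Local

/-! ### Forms and multivector fields on a manifold -/

section Manifold

variable {E : Type*} [NormedAddCommGroup E] [NormedSpace ℝ E]
  {M : Type*} [TopologicalSpace M] [ChartedSpace E M]

variable (E M) in
/-- Sections of the exterior algebra of the cotangent bundle (of no specified regularity). -/
abbrev FormField : Type _ := (x : M) → Forms (TangentSpace 𝓘(ℝ, E) x)

variable (E M) in
/-- Sections of the exterior algebra of the tangent bundle (of no specified regularity). -/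
abbrev MultivectorField : Type _ := (x : M) → ExteriorAlgebra ℝ (TangentSpace 𝓘(ℝ, E) x)

/-- The derivative at `x` of the chart around `x₀`. -/
def chartDeriv (x₀ x : M) : TangentSpace 𝓘(ℝ, E) x →L[ℝ] E :=
  mfderiv 𝓘(ℝ, E) 𝓘(ℝ, E) (extChartAt 𝓘(ℝ, E) x₀) x

/-- The derivative at `y` of the inverse of the chart around `x₀`. -/
def chartSymmDeriv (x₀ : M) (y : E) :
    E →L[ℝ] TangentSpace 𝓘(ℝ, E) ((extChartAt 𝓘(ℝ, E) x₀).symm y) :=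
  mfderiv 𝓘(ℝ, E) 𝓘(ℝ, E) (extChartAt 𝓘(ℝ, E) x₀).symm y

/-- The derivative of the inverse of the chart around `x`, at the point of the chart that
represents `x`. -/
def chartSymmDerivAt (x : M) : E →L[ℝ] TangentSpace 𝓘(ℝ, E) x :=
  (chartDeriv x x).inverse

/-- The coordinate expression of a form in the chart around `x₀`. -/
def FormField.inChart (η : FormField E M) (x₀ : M) (y : E) : Forms E :=
  fun a => (η ((extChartAt 𝓘(ℝ, E) x₀).symm y) a).compContinuousLinearMap (chartSymmDeriv x₀ y)

/-- The coordinate expression of a multivector field in the chart around `x₀`. -/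
def MultivectorField.inChart (X : MultivectorField E M) (x₀ : M) (y : E) : ExteriorAlgebra ℝ E :=
  ExteriorAlgebra.map (chartDeriv x₀ ((extChartAt 𝓘(ℝ, E) x₀).symm y)).toLinearMap
    (X ((extChartAt 𝓘(ℝ, E) x₀).symm y))

/-- `η ∈ Ω^k(M)`: a smooth form, homogeneous of degree `k`. In particular `Ω^k(M) = 0` for
`k < 0`. -/
structure IsForm (k : ℤ) (η : FormField E M) : Prop where
  homogeneous : ∀ (x : M) (a : ℕ), (a : ℤ) ≠ k → η x a = 0
  smooth : ∀ (x₀ : M) (a : ℕ),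
    ContDiffOn ℝ ∞ (fun y => η.inChart x₀ y a) (extChartAt 𝓘(ℝ, E) x₀).target

/-- The interior product `ι_X η` of a form with a multivector field. -/
def interiorField (X : MultivectorField E M) (η : FormField E M) : FormField E M :=
  fun x => interiorProd (X x) (η x)

variable [FiniteDimensional ℝ E]

/-- `X ∈ 𝔛^p(M)`: a smooth section of `⋀^p TM`. In particular `𝔛^p(M) = 0` for `p < 0`. -/
structure IsMultivector (p : ℤ) (X : MultivectorField E M) : Prop where
  homogeneous : ∀ x : M, X x ∈ multivectors (TangentSpace 𝓘(ℝ, E) x) p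
  smooth : ∀ x₀ : M,
    ContDiffOn ℝ ∞ (X.inChart x₀) (extChartAt 𝓘(ℝ, E) x₀).target

/-- The exterior derivative, computed at `x` in the chart around `x`. -/
def extD (η : FormField E M) : FormField E M := fun x a =>
  (extDerivLocal (η.inChart x) (extChartAt 𝓘(ℝ, E) x x) a).compContinuousLinearMap
    (chartDeriv x x)

/-- The Schouten–Nijenhuis bracket of a `p`-vector field `X` with a multivector field `Y`,
computed at `x` in the chart around `x`. -/
def schouten (p : ℤ) (X Y : MultivectorField E M) : MultivectorField E M := fun x =>
  ExteriorAlgebra.map (chartSymmDerivAt x).toLinearMap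
    (schoutenLocal p (X.inChart x) (Y.inChart x) (extChartAt 𝓘(ℝ, E) x x))

/-- The Lie derivative `ℒ_X η = d ι_X η - (-1)^p ι_X dη` along a `p`-vector field. -/
def lieD (p : ℤ) (X : MultivectorField E M) (η : FormField E M) : FormField E M :=
  extD (interiorField X η) - (-1 : ℝ) ^ p • interiorField X (extD η)

/-! ### Conformal Hamiltonian forms and their bracket -/

/-- `X ∈ 𝔛^p(M)` is an infinitesimal conformal transformation of `Θ`: there is `V ∈ 𝔛^(p-1)(M)`
with `ℒ_X Θ = ι_V Θ`. -/
def IsConformalTransformation (Θ : FormField E M) (p : ℤ) (X : MultivectorField E M) : Prop :=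
  IsMultivector p X ∧
    ∃ V : MultivectorField E M, IsMultivector (p - 1) V ∧ lieD p X Θ = interiorField V Θ

/-- `X ∈ 𝔛^p(M)` is an infinitesimal conformal transformation of `Θ` with `ι_X Θ = -α`. -/
def IsConformalTransformationFor (Θ : FormField E M) (p : ℤ) (α : FormField E M)
    (X : MultivectorField E M) : Prop :=
  IsConformalTransformation Θ p X ∧ interiorField X Θ = -α

/-- For `Θ` of degree `n`: the form `α ∈ Ω^(n-p)(M)` is a conformal Hamiltonian form. -/
def IsConformalHamiltonian (n : ℕ) (Θ : FormField E M) (p : ℤ) (α : FormField E M) : Prop :=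
  IsForm (n - p) α ∧ ∃ X : MultivectorField E M, IsConformalTransformationFor Θ p α X

open Classical in
/-- The graded Jacobi bracket `{α, β} = -ι_{[X_α, X_β]} Θ` of conformal Hamiltonian forms
`α ∈ Ω^(n-p)(M)` and `β ∈ Ω^(n-q)(M)`, where `X_α` and `X_β` are infinitesimal conformal
transformations with `ι_{X_α} Θ = -α` and `ι_{X_β} Θ = -β`, chosen arbitrarily. (The value is `0`
by convention if there are none, that is, if `α` or `β` is not conformal Hamiltonian.) -/
def jacobiBracket (Θ : FormField E M) (p q : ℤ) (α β : FormField E M) : FormField E M :=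
  if h : (∃ X, IsConformalTransformationFor Θ p α X) ∧
      (∃ Y, IsConformalTransformationFor Θ q β Y) then
    -interiorField (schouten p h.1.choose h.2.choose) Θ
  else 0

end Manifold

end GradedJacobi
end

open GradedJacobi

/-!
The proof reduces to two commutation relations for `d`, `ι` and `ℒ` on smooth forms, with
`ℒ_X = d ι_X - (-1)^p ι_X d`:

* `ι_[X, Y] = (-1)^((p-1)q) ℒ_X ι_Y - ι_Y ℒ_X` (`interiorField_schouten`),
* `ℒ_[X, Y] = (-1)^((p-1)(q-1)) ℒ_X ℒ_Y - ℒ_Y ℒ_X` (`lieD_schouten`),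

the second being a formal consequence of the first and of `d² = 0`.

The first one is local. In coordinates `d = ∑ dxⁱ ∧ ∂ᵢ`, and `ι_{dxⁱ ⌟ u}` is a twisted commutator
of `ι_u` with `dxⁱ ∧ ·` (`contraction_contractLeft`); inserting this into the right-hand side, all
derivatives of the form cancel and the coordinate formula of the Schouten bracket is left
(`contraction_schoutenLocal`). On the manifold, `d` and the Schouten bracket are computed at each
point in the chart of that point, so both have to be shown independent of the chart. For `d` this is
the naturality of `extDeriv` under pull-back. For the bracket no second computation is needed: in
finite dimension a multivector is determined by its interior products with forms
(`contraction_injective`), so the naturality of the bracket (`map_schoutenLocal`) follows from that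
of `d` through the first relation.

For conformal transformations, with `ℒ_X Θ = ι_V Θ` and `ℒ_Y Θ = ι_W Θ`, the relations give
`ℒ_[X, Y] Θ = ι_U Θ` with `U = [X, W] - (-1)^((p-1)(q-1)) [Y, V]`
(`IsConformalTransformation.schouten`). They also give
`ι_[X, Y] Θ = (-1)^((p-1)q) (ℒ_X ι_Y Θ - ι_V ι_Y Θ)`, which depends on `Y` only through `ι_Y Θ`;
by skew-symmetry it depends on `X` only through `ι_X Θ`, so the bracket of forms is well defined
(`interiorField_schouten_congr`). The graded Jacobi identity is the expansion of all double brackets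
into words in `ℒ_X`, `ℒ_Y` and `ι_Z` (`interiorField_schouten_jacobi`).
-/

noncomputable section

namespace GradedJacobi

/-! ### The interior product as an anti-homomorphism -/

section InteriorProduct

variable {V : Type*} [AddCommGroup V] [Module ℝ V] [TopologicalSpace V]

/-- The operator `η ↦ ι_u η`, linear in the multivector `u`. -/
def contraction : ExteriorAlgebra ℝ V →ₗ[ℝ] Module.End ℝ (Forms V) :=
  (MulOpposite.opLinearEquiv ℝ).symm.toLinearMap ∘ₗ contractHom.toLinearMap

theorem contraction_mul (u w : ExteriorAlgebra ℝ V) :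
    contraction (u * w) = contraction w * contraction u := by
  simp [contraction]

theorem contraction_algebraMap (c : ℝ) :
    contraction (algebraMap ℝ (ExteriorAlgebra ℝ V) c) = c • (1 : Module.End ℝ (Forms V)) := by
  rw [Algebra.algebraMap_eq_smul_one, map_smul]
  simp [contraction]

theorem contraction_ι (v : V) :
    contraction (ExteriorAlgebra.ι ℝ v) = iotaVec v := by
  simp only [contraction, contractHom, LinearMap.comp_apply, AlgHom.toLinearMap_apply,
    ExteriorAlgebra.lift_ι_apply]
  rfl

theorem contraction_ι_apply (v : V) (η : Forms V) (a : ℕ) :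
    contraction (ExteriorAlgebra.ι ℝ v) η a = contractVec v (η (a + 1)) := by
  rw [contraction_ι]; rfl

/-- `neg_smul` does not apply to forms up to reducible unfolding, as the additive monoid underlying
the module structure and the one underlying the additive group have different definitions. -/
theorem Forms.neg_one_smul (η : Forms V) : (-1 : ℝ) • η = -η := by
  funext a
  ext m
  exact neg_one_mul (η a m)

omit [TopologicalSpace V] in
@[elab_as_elim]
theorem exteriorAlgebra_induction_left {P : ExteriorAlgebra ℝ V → Prop}
    (u : ExteriorAlgebra ℝ V)
    (scalar : ∀ c : ℝ, P (algebraMap ℝ _ c)) (add : ∀ u w, P u → P w → P (u + w))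
    (vec_mul : ∀ v u, P u → P (ExteriorAlgebra.ι ℝ v * u)) : P u :=
  CliffordAlgebra.left_induction (0 : QuadraticForm ℝ V) scalar add
    (fun u v h => vec_mul v u h) u

section Pullback

variable {W : Type*} [AddCommGroup W] [Module ℝ W] [TopologicalSpace W]

/-- The pull-back of forms along a linear map. -/
def Forms.pullback (B : V →L[ℝ] W) : Forms W →ₗ[ℝ] Forms V where
  toFun η a := (η a).compContinuousLinearMap B
  map_add' _ _ := rfl
  map_smul' _ _ := rfl

theorem Forms.pullback_apply (B : V →L[ℝ] W) (η : Forms W) (a : ℕ) (m : Fin a → V) :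
    Forms.pullback B η a m = η a (fun i => B (m i)) := rfl

theorem contractVec_compContinuousLinearMap {a : ℕ} (B : V →L[ℝ] W) (v : V)
    (η : W [⋀^Fin (a + 1)]→L[ℝ] ℝ) :
    contractVec v (η.compContinuousLinearMap B) =
      (contractVec (B v) η).compContinuousLinearMap B := by
  ext m
  simp only [contractVec_apply, ContinuousAlternatingMap.compContinuousLinearMap_apply]
  congr 1
  funext i
  cases i using Fin.cases <;> simp

/-- Naturality of the interior product: `B^*(ι_{B u} η) = ι_u (B^* η)`. -/
theorem pullback_contraction (B : V →L[ℝ] W) (u : ExteriorAlgebra ℝ V) (η : Forms W) :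
    Forms.pullback B (contraction (ExteriorAlgebra.map B.toLinearMap u) η) =
      contraction u (Forms.pullback B η) := by
  induction u using exteriorAlgebra_induction_left generalizing η with
  | scalar c => simp [contraction_algebraMap]
  | add u w hu hw => simp only [map_add, LinearMap.add_apply, hu, hw]
  | vec_mul v u hu =>
    simp only [map_mul, contraction_mul, Module.End.mul_apply, hu]
    congr 1
    rw [ExteriorAlgebra.map_apply_ι, contraction_ι, contraction_ι]
    exact funext fun a => (contractVec_compContinuousLinearMap B v _).symm

end Pullback

end InteriorProduct

/-! ### Degrees in the exterior algebra -/

section Degree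

variable {V : Type*} [AddCommGroup V] [Module ℝ V]

theorem mem_multivectors_iff {p : ℤ} {u : ExteriorAlgebra ℝ V} :
    u ∈ multivectors V p ↔ u = 0 ∨ ∃ k : ℕ, p = k ∧ u ∈ ⋀[ℝ]^k V := by
  cases p with
  | ofNat k =>
    simp only [multivectors, Int.ofNat_eq_natCast, Nat.cast_inj]
    constructor
    · exact fun h => Or.inr ⟨k, rfl, h⟩
    · rintro (rfl | ⟨k, rfl, h⟩)
      · exact zero_mem _
      · exact h
  | negSucc k =>
    simp only [multivectors, Submodule.mem_bot]
    constructor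
    · exact Or.inl
    · rintro (rfl | ⟨l, h, -⟩)
      · rfl
      · omega

theorem mem_multivectors_natCast {k : ℕ} {u : ExteriorAlgebra ℝ V} :
    u ∈ multivectors V k ↔ u ∈ ⋀[ℝ]^k V := Iff.rfl

theorem mul_mem_multivectors {p q : ℤ} {u w : ExteriorAlgebra ℝ V}
    (hu : u ∈ multivectors V p) (hw : w ∈ multivectors V q) :
    u * w ∈ multivectors V (p + q) := by
  rcases mem_multivectors_iff.1 hu with rfl | ⟨k, rfl, hk⟩
  · simp
  rcases mem_multivectors_iff.1 hw with rfl | ⟨l, rfl, hl⟩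
  · simp
  rw [← Nat.cast_add, mem_multivectors_natCast]
  exact SetLike.mul_mem_graded (A := fun i : ℕ => ⋀[ℝ]^i V) hk hl

theorem ι_mem_multivectors (v : V) : ExteriorAlgebra.ι ℝ v ∈ multivectors V 1 := by
  rw [← Nat.cast_one, mem_multivectors_natCast]
  change _ ∈ LinearMap.range (ExteriorAlgebra.ι ℝ : V →ₗ[ℝ] ExteriorAlgebra ℝ V) ^ 1
  rw [pow_one]
  exact LinearMap.mem_range_self _ v

theorem ι_mul_mem_multivectors (v : V) {p : ℤ} {u : ExteriorAlgebra ℝ V}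
    (hu : u ∈ multivectors V p) : ExteriorAlgebra.ι ℝ v * u ∈ multivectors V (p + 1) :=
  add_comm 1 p ▸ mul_mem_multivectors (ι_mem_multivectors v) hu

theorem algebraMap_mem_multivectors (c : ℝ) :
    algebraMap ℝ (ExteriorAlgebra ℝ V) c ∈ multivectors V 0 := by
  rw [← Nat.cast_zero, mem_multivectors_natCast]
  exact SetLike.algebraMap_mem_graded (fun i : ℕ => ⋀[ℝ]^i V) c

/-- Induction over the multivectors of degree `p`, by wedging with vectors from the left. -/
@[elab_as_elim]
theorem multivectors_induction {P : (p : ℤ) → (u : ExteriorAlgebra ℝ V) →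
    u ∈ multivectors V p → Prop}
    (zero : ∀ p, P p 0 (zero_mem _))
    (scalar : ∀ c : ℝ, P 0 (algebraMap ℝ _ c) (algebraMap_mem_multivectors c))
    (add : ∀ p u w (hu : u ∈ multivectors V p) (hw : w ∈ multivectors V p),
      P p u hu → P p w hw → P p (u + w) (add_mem hu hw))
    (vec_mul : ∀ p v u (hu : u ∈ multivectors V p), P p u hu →
      P (p + 1) (ExteriorAlgebra.ι ℝ v * u) (ι_mul_mem_multivectors v hu))
    {p : ℤ} {u : ExteriorAlgebra ℝ V} (hu : u ∈ multivectors V p) :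
    P p u hu := by
  rcases mem_multivectors_iff.1 hu with rfl | ⟨k, rfl, h⟩
  · exact zero p
  · refine Submodule.pow_induction_on_left'
      (M := LinearMap.range (ExteriorAlgebra.ι ℝ : V →ₗ[ℝ] ExteriorAlgebra ℝ V))
      (C := fun k u hu => P (k : ℤ) u hu) ?_ ?_ ?_ h
    · exact fun c => scalar c
    · exact fun u w k hu hw => add k u w hu hw
    · rintro _ ⟨v, rfl⟩ k u hu h
      exact vec_mul k v u hu h

theorem map_mem_multivectors {W : Type*} [AddCommGroup W] [Module ℝ W] (B : V →ₗ[ℝ] W) {p : ℤ}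
    {u : ExteriorAlgebra ℝ V} (hu : u ∈ multivectors V p) :
    ExteriorAlgebra.map B u ∈ multivectors W p := by
  induction hu using multivectors_induction with
  | zero p => simp
  | scalar c =>
    rw [AlgHom.commutes]
    exact algebraMap_mem_multivectors c
  | add p u w _ _ hu hw => simpa using add_mem hu hw
  | vec_mul p v u _ hu =>
    rw [map_mul, ExteriorAlgebra.map_apply_ι]
    exact ι_mul_mem_multivectors _ hu

theorem neg_one_zpow_mul_self (p : ℤ) : (-1 : ℝ) ^ p * (-1 : ℝ) ^ p = 1 := by
  rcases Int.even_or_odd p with h | h <;> simp [h.neg_one_zpow]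

theorem involute_eq_smul {p : ℤ} {u : ExteriorAlgebra ℝ V} (hu : u ∈ multivectors V p) :
    CliffordAlgebra.involute u = (-1 : ℝ) ^ p • u := by
  induction hu using multivectors_induction with
  | zero p => simp
  | scalar c => simp
  | add p u w _ _ hu hw => rw [map_add, hu, hw, smul_add]
  | vec_mul p v u _ hu =>
    rw [map_mul, hu, zpow_add_one₀ (by norm_num)]
    erw [CliffordAlgebra.involute_ι]
    simp

theorem contractLeft_mem_multivectors (f : Module.Dual ℝ V) {p : ℤ} {u : ExteriorAlgebra ℝ V}
    (hu : u ∈ multivectors V p) : CliffordAlgebra.contractLeft f u ∈ multivectors V (p - 1) := by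
  induction hu using multivectors_induction with
  | zero p => simp
  | scalar c => simp
  | add p u w _ _ hu hw => simpa using add_mem hu hw
  | vec_mul p v u h hu =>
    erw [CliffordAlgebra.contractLeft_ι_mul]
    rw [add_sub_cancel_right]
    refine sub_mem (Submodule.smul_mem _ _ h) ?_
    simpa using ι_mul_mem_multivectors v hu

theorem mul_ι_eq_smul {p : ℤ} {u : ExteriorAlgebra ℝ V} (hu : u ∈ multivectors V p) (v : V) :
    u * ExteriorAlgebra.ι ℝ v = (-1 : ℝ) ^ p • (ExteriorAlgebra.ι ℝ v * u) := by
  induction hu using multivectors_induction with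
  | zero p => simp
  | scalar c => simpa using Algebra.commutes c (ExteriorAlgebra.ι ℝ v)
  | add p u w _ _ hu hw => rw [add_mul, hu, hw, mul_add, smul_add]
  | vec_mul p w u h hu =>
    have hswap : ExteriorAlgebra.ι ℝ w * ExteriorAlgebra.ι ℝ v =
        -(ExteriorAlgebra.ι ℝ v * ExteriorAlgebra.ι ℝ w) :=
      eq_neg_of_add_eq_zero_left (ExteriorAlgebra.ι_add_mul_swap w v)
    rw [mul_assoc, hu, mul_smul_comm, ← mul_assoc, hswap, zpow_add_one₀ (by norm_num)]
    simp [mul_assoc]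

/-- Graded commutativity of the exterior algebra. -/
theorem mul_comm_smul {p q : ℤ} {u w : ExteriorAlgebra ℝ V}
    (hu : u ∈ multivectors V p) (hw : w ∈ multivectors V q) :
    u * w = (-1 : ℝ) ^ (p * q) • (w * u) := by
  induction hw using multivectors_induction with
  | zero p => simp
  | scalar c => simpa using (Algebra.commutes c u).symm
  | add q w w' _ _ hw hw' => rw [mul_add, hw, hw', add_mul, smul_add]
  | vec_mul q v w h hw =>
    rw [← mul_assoc, mul_ι_eq_smul hu, smul_mul_assoc, mul_assoc, hw, mul_add, mul_one,
      zpow_add₀ (by norm_num), mul_smul_comm, smul_smul, mul_comm ((-1 : ℝ) ^ p), mul_assoc]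

variable [TopologicalSpace V]

theorem contraction_comm_smul {p q : ℤ} {u w : ExteriorAlgebra ℝ V}
    (hu : u ∈ multivectors V p) (hw : w ∈ multivectors V q) (η : Forms V) :
    contraction u (contraction w η) = (-1 : ℝ) ^ (p * q) • contraction w (contraction u η) := by
  rw [← Module.End.mul_apply, ← contraction_mul, mul_comm_smul hw hu, map_smul, contraction_mul,
    mul_comm q p]
  rfl

/-- The interior product with a `p`-vector lowers degrees by `p`. -/
theorem contraction_homogeneous {p k : ℤ} {u : ExteriorAlgebra ℝ V} (hu : u ∈ multivectors V p)
    {η : Forms V} (hη : ∀ a : ℕ, (a : ℤ) ≠ k → η a = 0) (a : ℕ) (ha : (a : ℤ) ≠ k - p) :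
    contraction u η a = 0 := by
  induction hu using multivectors_induction generalizing η a k with
  | zero p => simp
  | scalar c =>
    rw [contraction_algebraMap]
    simp [hη a (by simpa using ha)]
  | add p u w _ _ hu hw =>
    rw [map_add, LinearMap.add_apply, Pi.add_apply, hu hη a ha, hw hη a ha, add_zero]
  | vec_mul p v u h hu =>
    rw [contraction_mul, Module.End.mul_apply]
    refine hu (k := k - 1) (fun b hb => ?_) a (by omega)
    rw [contraction_ι_apply, hη (b + 1) (by push_cast; omega)]
    rfl

end Degree

/-! ### Faithfulness of the interior product -/

section Faithful

variable {E : Type*} [NormedAddCommGroup E] [NormedSpace ℝ E]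

/-- The pairing of a multivector with a form is the degree-zero part of the interior product. -/
theorem liftAlternating_eq_contraction (u : ExteriorAlgebra ℝ E) (η : Forms E) :
    ExteriorAlgebra.liftAlternating (fun a => (η a).toAlternatingMap) u =
      contraction u η 0 ![] := by
  induction u using exteriorAlgebra_induction_left generalizing η with
  | scalar c =>
    rw [ExteriorAlgebra.liftAlternating_algebraMap, contraction_algebraMap]
    simp only [LinearMap.smul_apply, Module.End.one_apply, Pi.smul_apply]
    congr 1
    exact congrArg (η 0) (Subsingleton.elim _ _)
  | add u w hu hw =>
    simp only [map_add, LinearMap.add_apply, hu, hw]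
    rfl
  | vec_mul v u hu =>
    rw [ExteriorAlgebra.liftAlternating_ι_mul, contraction_mul, Module.End.mul_apply, ← hu]
    congr 2
    funext a
    rw [contraction_ι_apply]
    rfl

variable [FiniteDimensional ℝ E]

theorem _root_.AlternatingMap.continuous_of_finiteDimensional {ι : Type*} [Fintype ι]
    [DecidableEq ι] (f : E [⋀^ι]→ₗ[ℝ] ℝ) : Continuous f := by
  have h : (f : (ι → E) → ℝ) = fun m => ∑ r : ι → Fin (Module.finrank ℝ E),
      (∏ i, (Module.finBasis ℝ E).repr (m i) (r i)) • f fun i => Module.finBasis ℝ E (r i) := by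
    funext m
    conv_lhs => rw [show m = fun i => ∑ j, (Module.finBasis ℝ E).repr (m i) j •
      Module.finBasis ℝ E j from funext fun i => ((Module.finBasis ℝ E).sum_repr (m i)).symm]
    erw [f.toMultilinearMap.map_sum]
    refine Finset.sum_congr rfl fun r _ => ?_
    exact f.toMultilinearMap.map_smul_univ _ _
  rw [h]
  refine continuous_finsetSum _ fun r _ => Continuous.smul (f := fun m : ι → E =>
    ∏ i, (Module.finBasis ℝ E).repr (m i) (r i)) (continuous_finsetProd _ fun i _ => ?_)
    continuous_const
  exact ((Module.finBasis ℝ E).coord (r i)).continuous_of_finiteDimensional.comp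
    (continuous_apply i)

/-- In finite dimension a multivector is determined by its interior products with forms: every
linear functional on the exterior algebra is the pairing with some form. -/
theorem contraction_injective : Function.Injective (contraction (V := E)) := by
  refine (injective_iff_map_eq_zero _).2 fun u hu => ?_
  refine (Module.forall_dual_apply_eq_zero_iff ℝ u).1 fun φ => ?_
  obtain ⟨f, rfl⟩ := ExteriorAlgebra.liftAlternatingEquiv.surjective φ
  let η : Forms E := fun a => { f a with cont := (f a).continuous_of_finiteDimensional }
  have h := liftAlternating_eq_contraction u η
  rw [hu] at h
  exact h

end Faithful

/-! ### Exterior multiplication by a covector -/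

section Wedge

variable {E : Type*} [NormedAddCommGroup E] [NormedSpace ℝ E]

/-- The exterior multiplication `η ↦ f ∧ η` by a covector `f`. -/
def wedgeCovector (f : E →L[ℝ] ℝ) : Module.End ℝ (Forms E) where
  toFun η
    | 0 => 0
    | a + 1 => ContinuousAlternatingMap.alternatizeUncurryFin (f.smulRight (η a))
  map_add' η ζ := by
    funext a
    cases a with
    | zero => simp
    | succ a =>
      simp only [Pi.add_apply, ← ContinuousAlternatingMap.alternatizeUncurryFin_add]
      congr 1
      ext v : 1
      simp
  map_smul' c η := by
    funext a
    cases a with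
    | zero => simp
    | succ a =>
      simp only [Pi.smul_apply, RingHom.id_apply,
        ← ContinuousAlternatingMap.alternatizeUncurryFin_smul]
      congr 1
      ext v : 1
      simp [smul_comm c]

theorem wedgeCovector_succ (f : E →L[ℝ] ℝ) (η : Forms E) (a : ℕ) :
    wedgeCovector f η (a + 1) =
      ContinuousAlternatingMap.alternatizeUncurryFin (f.smulRight (η a)) := rfl

/-- The canonical anticommutation relation `ι_v (f ∧ η) = f(v) η - f ∧ ι_v η`. -/
theorem iotaVec_wedgeCovector (f : E →L[ℝ] ℝ) (v : E) (η : Forms E) :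
    iotaVec v (wedgeCovector f η) = f v • η - wedgeCovector f (iotaVec v η) := by
  funext a
  ext m
  change wedgeCovector f η (a + 1) (Matrix.vecCons v m) =
    f v • η a m - wedgeCovector f (iotaVec v η) a m
  rw [wedgeCovector_succ, ContinuousAlternatingMap.alternatizeUncurryFin_apply,
    Fin.sum_univ_succ]
  have h0 : Fin.removeNth 0 (Matrix.vecCons v m) = m := rfl
  rw [h0]
  cases a with
  | zero =>
    have h : wedgeCovector f (iotaVec v η) 0 = 0 := rfl
    simp [h]
  | succ a =>
    rw [wedgeCovector_succ, ContinuousAlternatingMap.alternatizeUncurryFin_apply]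
    have hr : ∀ i : Fin (a + 1), Fin.removeNth i.succ (Matrix.vecCons v m) =
        Matrix.vecCons v (i.removeNth m) := by
      intro i
      funext j
      cases j using Fin.cases <;> simp [Fin.removeNth_apply]
    have hi : ∀ m' : Fin a → E, iotaVec v η a m' = η (a + 1) (Matrix.vecCons v m') :=
      fun _ => rfl
    simp [hr, hi, pow_succ, sub_eq_add_neg]

/-- The interior product with `f ⌟ u`, as a twisted commutator of `ι_u` with `f ∧ ·`. -/
theorem contraction_contractLeft (f : E →L[ℝ] ℝ) (u : ExteriorAlgebra ℝ E) (η : Forms E) :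
    contraction (CliffordAlgebra.contractLeft (f : E →ₗ[ℝ] ℝ) u) η =
      contraction u (wedgeCovector f η) -
        wedgeCovector f (contraction (CliffordAlgebra.involute u) η) := by
  induction u using exteriorAlgebra_induction_left generalizing η with
  | scalar c => simp [contraction_algebraMap]
  | add u w hu hw =>
    simp only [map_add, LinearMap.add_apply, hu, hw]
    abel
  | vec_mul v u hu =>
    have h1 : CliffordAlgebra.contractLeft (f : E →ₗ[ℝ] ℝ) (ExteriorAlgebra.ι ℝ v * u) =
        f v • u - ExteriorAlgebra.ι ℝ v * CliffordAlgebra.contractLeft (f : E →ₗ[ℝ] ℝ) u :=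
      CliffordAlgebra.contractLeft_ι_mul (Q := (0 : QuadraticForm ℝ E)) (f : E →ₗ[ℝ] ℝ) v u
    have h2 : CliffordAlgebra.involute (ExteriorAlgebra.ι ℝ v * u) =
        -(ExteriorAlgebra.ι ℝ v * CliffordAlgebra.involute u) := by
      rw [map_mul]
      erw [CliffordAlgebra.involute_ι (Q := (0 : QuadraticForm ℝ E)) v]
      exact neg_mul _ _
    have h3 : contraction (f v • u - ExteriorAlgebra.ι ℝ v *
        CliffordAlgebra.contractLeft (f : E →ₗ[ℝ] ℝ) u) η = f v • contraction u η -
          contraction (CliffordAlgebra.contractLeft (f : E →ₗ[ℝ] ℝ) u) (iotaVec v η) := by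
      rw [map_sub, map_smul, contraction_mul, contraction_ι]
      rfl
    have h4 : contraction (-(ExteriorAlgebra.ι ℝ v * CliffordAlgebra.involute u)) η =
        -contraction (CliffordAlgebra.involute u) (iotaVec v η) := by
      rw [map_neg, contraction_mul, contraction_ι]
      rfl
    rw [h1, h2, h3, h4, contraction_mul, contraction_ι, Module.End.mul_apply,
      iotaVec_wedgeCovector, hu, map_sub, map_smul, map_neg]
    abel

theorem wedgeCovector_contraction {p : ℤ} {u : ExteriorAlgebra ℝ E} (hu : u ∈ multivectors E p)
    (f : E →L[ℝ] ℝ) (η : Forms E) :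
    wedgeCovector f (contraction u η) = (-1 : ℝ) ^ p • (contraction u (wedgeCovector f η) -
      contraction (CliffordAlgebra.contractLeft (f : E →ₗ[ℝ] ℝ) u) η) := by
  rw [contraction_contractLeft, involute_eq_smul hu, map_smul, LinearMap.smul_apply, map_smul,
    sub_sub_cancel, smul_smul, neg_one_zpow_mul_self, one_smul]

end Wedge

/-! ### Calculus of forms and multivector fields on a vector space -/

section LocalCalculus

open Filter Topology

theorem minSmoothness_two_le_infty : minSmoothness ℝ 2 ≤ ∞ := by
  rw [minSmoothness_of_isRCLikeNormedField]
  exact WithTop.coe_le_coe.2 (le_top : (2 : ℕ∞) ≤ ⊤)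

variable {E : Type*} [NormedAddCommGroup E] [NormedSpace ℝ E]

/-- The contraction with a fixed vector, as a continuous linear map. -/
def contractVecCLM (v : E) (a : ℕ) : (E [⋀^Fin (a + 1)]→L[ℝ] ℝ) →L[ℝ] (E [⋀^Fin a]→L[ℝ] ℝ) :=
  (ContinuousLinearMap.apply ℝ _ v).comp
    (ContinuousAlternatingMap.curryLeftLI (𝕜 := ℝ) (E := E) (F := ℝ)).toContinuousLinearMap

theorem contraction_ι_eq_contractVecCLM (v : E) (η : Forms E) (a : ℕ) :
    contraction (ExteriorAlgebra.ι ℝ v) η a = contractVecCLM v a (η (a + 1)) := by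
  rw [contraction_ι_apply]; rfl

/-- The derivative of a non-homogeneous form in the direction `v`, degree by degree. -/
def dirDeriv (η : E → Forms E) (y v : E) : Forms E := fun a => fderiv ℝ (fun z => η z a) y v

theorem contDiffOn_contraction_const {k : WithTop ℕ∞} {s : Set E} (u : ExteriorAlgebra ℝ E)
    {η : E → Forms E} (hη : ∀ a, ContDiffOn ℝ k (fun z => η z a) s) (a : ℕ) :
    ContDiffOn ℝ k (fun z => contraction u (η z) a) s := by
  induction u using exteriorAlgebra_induction_left generalizing η a with
  | scalar c =>
    simp only [contraction_algebraMap]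
    exact (hη a).const_smul c
  | add u w hu hw =>
    simp only [map_add]
    exact (hu hη a).add (hw hη a)
  | vec_mul v u hu =>
    simp only [contraction_mul, Module.End.mul_apply]
    refine hu (fun b => ?_) a
    simp only [contraction_ι_eq_contractVecCLM]
    exact (contractVecCLM v b).contDiff.comp_contDiffOn (hη (b + 1))

theorem differentiableAt_contraction_const {y : E} (u : ExteriorAlgebra ℝ E)
    {η : E → Forms E} (hη : ∀ a, DifferentiableAt ℝ (fun z => η z a) y) (a : ℕ) :
    DifferentiableAt ℝ (fun z => contraction u (η z) a) y := by
  induction u using exteriorAlgebra_induction_left generalizing η a with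
  | scalar c =>
    simp only [contraction_algebraMap]
    exact (hη a).const_smul c
  | add u w hu hw =>
    simp only [map_add]
    exact (hu hη a).add (hw hη a)
  | vec_mul v u hu =>
    simp only [contraction_mul, Module.End.mul_apply]
    refine hu (fun b => ?_) a
    simp only [contraction_ι_eq_contractVecCLM]
    exact (contractVecCLM v b).differentiableAt.comp y (hη (b + 1))

theorem dirDeriv_contraction_const {y : E} (u : ExteriorAlgebra ℝ E)
    {η : E → Forms E} (hη : ∀ a, DifferentiableAt ℝ (fun z => η z a) y) (v : E) :
    dirDeriv (fun z => contraction u (η z)) y v = contraction u (dirDeriv η y v) := by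
  induction u using exteriorAlgebra_induction_left generalizing η with
  | scalar c =>
    simp only [contraction_algebraMap]
    funext a
    exact congrArg (fun T : E →L[ℝ] _ => T v) (fderiv_const_smul (hη a) c)
  | add u w hu hw =>
    rw [map_add, LinearMap.add_apply, ← hu hη, ← hw hη]
    funext a
    exact congrArg (fun T : E →L[ℝ] _ => T v) (fderiv_add
      (differentiableAt_contraction_const u hη a) (differentiableAt_contraction_const w hη a))
  | vec_mul w u hu =>
    simp only [contraction_mul, Module.End.mul_apply]
    have hd : ∀ b, DifferentiableAt ℝ (fun z => contraction (ExteriorAlgebra.ι ℝ w) (η z) b) y :=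
      differentiableAt_contraction_const _ hη
    rw [hu hd]
    congr 1
    funext b
    rw [contraction_ι_eq_contractVecCLM]
    simp only [dirDeriv, contraction_ι_eq_contractVecCLM]
    exact congrArg (fun T : E →L[ℝ] _ => T v)
      ((contractVecCLM w b).hasFDerivAt.comp y (hη (b + 1)).hasFDerivAt).fderiv

variable [FiniteDimensional ℝ E]

theorem contraction_eq_sum (u : ExteriorAlgebra ℝ E) (η : Forms E) (a : ℕ) :
    contraction u η a = ∑ j, LinearMap.toContinuousLinearMap
      ((Module.finBasis ℝ (ExteriorAlgebra ℝ E)).coord j) u •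
        contraction (Module.finBasis ℝ (ExteriorAlgebra ℝ E) j) η a := by
  conv_lhs => rw [← (Module.finBasis ℝ (ExteriorAlgebra ℝ E)).sum_repr u, map_sum,
    LinearMap.sum_apply, Finset.sum_apply]
  simp

theorem contDiffOn_contraction {k : WithTop ℕ∞} {s : Set E} {X : E → ExteriorAlgebra ℝ E}
    {η : E → Forms E} (hX : ContDiffOn ℝ k X s) (hη : ∀ a, ContDiffOn ℝ k (fun z => η z a) s)
    (a : ℕ) : ContDiffOn ℝ k (fun z => contraction (X z) (η z) a) s := by
  simp only [contraction_eq_sum (X _)]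
  exact ContDiffOn.sum fun j _ => ContDiffOn.fun_smul
    ((ContinuousLinearMap.contDiff _).comp_contDiffOn hX) (contDiffOn_contraction_const _ hη a)

theorem differentiableAt_contraction {y : E} {X : E → ExteriorAlgebra ℝ E}
    {η : E → Forms E} (hX : DifferentiableAt ℝ X y)
    (hη : ∀ a, DifferentiableAt ℝ (fun z => η z a) y) (a : ℕ) :
    DifferentiableAt ℝ (fun z => contraction (X z) (η z) a) y := by
  simp only [contraction_eq_sum (X _)]
  exact DifferentiableAt.fun_sum fun j _ => DifferentiableAt.fun_smul
    ((ContinuousLinearMap.differentiableAt _).comp y hX) (differentiableAt_contraction_const _ hη a)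

/-- The product rule for the interior product. -/
theorem dirDeriv_contraction {y : E} {X : E → ExteriorAlgebra ℝ E} {η : E → Forms E}
    (hX : DifferentiableAt ℝ X y) (hη : ∀ a, DifferentiableAt ℝ (fun z => η z a) y) (v : E) :
    dirDeriv (fun z => contraction (X z) (η z)) y v =
      contraction (fderiv ℝ X y v) (η y) + contraction (X y) (dirDeriv η y v) := by
  funext a
  have h := HasFDerivAt.fun_sum (u := Finset.univ) fun j _ => HasFDerivAt.fun_smul
    ((LinearMap.toContinuousLinearMap
      ((Module.finBasis ℝ (ExteriorAlgebra ℝ E)).coord j)).hasFDerivAt.comp y hX.hasFDerivAt)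
    (differentiableAt_contraction_const (Module.finBasis ℝ (ExteriorAlgebra ℝ E) j)
      hη a).hasFDerivAt
  have e : (fun z => contraction (X z) (η z) a) = _ :=
    funext fun z => contraction_eq_sum (X z) (η z) a
  rw [dirDeriv, e]
  erw [h.fderiv]
  rw [Pi.add_apply, contraction_eq_sum (fderiv ℝ X y v), contraction_eq_sum (X y),
    ← Finset.sum_add_distrib, sum_apply]
  refine Finset.sum_congr rfl fun j _ => ?_
  rw [← dirDeriv_contraction_const _ hη, add_comm]
  rfl

omit [FiniteDimensional ℝ E] in
/-- The derivative of a function with values in a subspace takes values in that subspace. -/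
theorem fderiv_mem_submodule {F : Type*} [NormedAddCommGroup F] [NormedSpace ℝ F]
    [FiniteDimensional ℝ F] (S : Submodule ℝ F) {f : E → F} {y : E}
    (hf : DifferentiableAt ℝ f y) (hS : ∀ᶠ z in 𝓝 y, f z ∈ S) (v : E) : fderiv ℝ f y v ∈ S := by
  obtain ⟨g, hg⟩ := S.subtype.exists_leftInverse_of_injective S.ker_subtype
  -- a projection of `F` onto `S`, so that `f = P ∘ f` near `y`
  let P : F →L[ℝ] F := LinearMap.toContinuousLinearMap (S.subtype ∘ₗ g)
  have hP : f =ᶠ[𝓝 y] fun z => P (f z) := by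
    filter_upwards [hS] with z hz
    exact (congrArg Subtype.val (LinearMap.congr_fun hg ⟨f z, hz⟩)).symm
  rw [hP.fderiv_eq, show fderiv ℝ (fun z => P (f z)) y = P.comp (fderiv ℝ f y) from
    (P.hasFDerivAt.comp y hf.hasFDerivAt).fderiv]
  exact (g _).2

/-- The exterior derivative as `∑ᵢ dxⁱ ∧ ∂ᵢ`. -/
theorem extDerivLocal_eq_sum (η : E → Forms E) (y : E) :
    extDerivLocal η y = ∑ i, wedgeCovector
      (LinearMap.toContinuousLinearMap ((Module.finBasis ℝ E).coord i))
      (dirDeriv η y (Module.finBasis ℝ E i)) := by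
  funext a
  rw [Finset.sum_apply]
  cases a with
  | zero => exact (Finset.sum_const_zero).symm
  | succ a =>
    simp only [wedgeCovector_succ]
    change ContinuousAlternatingMap.alternatizeUncurryFinCLM ℝ E ℝ _ =
      ∑ i, ContinuousAlternatingMap.alternatizeUncurryFinCLM ℝ E ℝ _
    rw [← map_sum]
    congr 1
    ext v : 1
    conv_lhs => rw [← (Module.finBasis ℝ E).sum_repr v, map_sum]
    rw [sum_apply]
    simp [dirDeriv]

omit [FiniteDimensional ℝ E] in
theorem extDerivLocal_congr {η ζ : E → Forms E} {y : E} (h : η =ᶠ[𝓝 y] ζ) :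
    extDerivLocal η y = extDerivLocal ζ y := by
  funext a
  cases a with
  | zero => rfl
  | succ a =>
    exact Filter.EventuallyEq.extDeriv_eq (h.mono fun z hz => congrFun hz a)

omit [FiniteDimensional ℝ E] in
theorem contDiffOn_extDerivLocal {s : Set E} (hs : IsOpen s) {η : E → Forms E}
    (hη : ∀ a, ContDiffOn ℝ ∞ (fun z => η z a) s) (a : ℕ) :
    ContDiffOn ℝ ∞ (fun z => extDerivLocal η z a) s := by
  cases a with
  | zero => exact contDiffOn_const
  | succ a =>
    exact (ContinuousAlternatingMap.alternatizeUncurryFinCLM ℝ E ℝ).contDiff.comp_contDiffOn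
      ((hη a).fderiv_of_isOpen (m := ∞) hs (by simp))

omit [FiniteDimensional ℝ E] in
theorem extDerivLocal_extDerivLocal {η : E → Forms E} {y : E}
    (hη : ∀ a, ContDiffAt ℝ ∞ (fun z => η z a) y) :
    extDerivLocal (extDerivLocal η) y = 0 := by
  funext a
  match a with
  | 0 => rfl
  | 1 =>
    change extDeriv (fun z => (0 : E [⋀^Fin 0]→L[ℝ] ℝ)) y = 0
    rw [extDeriv, fderiv_fun_const]
    exact map_zero (ContinuousAlternatingMap.alternatizeUncurryFinCLM ℝ E ℝ)
  | a + 2 => exact extDeriv_extDeriv_apply (hη a) minSmoothness_two_le_infty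

omit [FiniteDimensional ℝ E] in
theorem extDerivLocal_pullback {ψ : E → E} {ζ : E → Forms E} {y : E}
    (hψ : ContDiffAt ℝ ∞ ψ y) (hζ : ∀ a, DifferentiableAt ℝ (fun z => ζ z a) (ψ y)) :
    extDerivLocal (fun z => Forms.pullback (fderiv ℝ ψ z) (ζ (ψ z))) y =
      Forms.pullback (fderiv ℝ ψ y) (extDerivLocal ζ (ψ y)) := by
  funext a
  cases a with
  | zero => rfl
  | succ a => exact extDeriv_pullback (hζ a) hψ minSmoothness_two_le_infty

end LocalCalculus

/-! ### The Schouten–Nijenhuis bracket on a vector space -/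

section LocalSchouten

open Filter Topology

theorem neg_one_zpow_eq_ite (k : ℤ) : (-1 : ℝ) ^ k = if Even k then 1 else -1 := by
  split_ifs with h
  · exact h.neg_one_zpow
  · exact (Int.not_even_iff_odd.1 h).neg_one_zpow

variable {E : Type*} [NormedAddCommGroup E] [NormedSpace ℝ E] [FiniteDimensional ℝ E]

/-- The Lie derivative in coordinates: `ℒ_X η = ∑ᵢ dxⁱ ∧ ι_{∂ᵢX} η - (-1)^p ι_{dxⁱ ⌟ X} ∂ᵢη`. -/
theorem lieLocal_eq_sum {p : ℤ} {X : E → ExteriorAlgebra ℝ E} {η : E → Forms E} {y : E}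
    (hp : ∀ᶠ z in 𝓝 y, X z ∈ multivectors E p) (hX : DifferentiableAt ℝ X y)
    (hη : ∀ a, DifferentiableAt ℝ (fun z => η z a) y) :
    extDerivLocal (fun z => contraction (X z) (η z)) y -
        (-1 : ℝ) ^ p • contraction (X y) (extDerivLocal η y) =
      ∑ i, (wedgeCovector (LinearMap.toContinuousLinearMap ((Module.finBasis ℝ E).coord i))
          (contraction (fderiv ℝ X y (Module.finBasis ℝ E i)) (η y)) -
        (-1 : ℝ) ^ p • contraction
          (CliffordAlgebra.contractLeft ((Module.finBasis ℝ E).coord i) (X y))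
            (dirDeriv η y (Module.finBasis ℝ E i))) := by
  rw [extDerivLocal_eq_sum, extDerivLocal_eq_sum, map_sum, Finset.smul_sum,
    ← Finset.sum_sub_distrib]
  refine Finset.sum_congr rfl fun i _ => ?_
  rw [dirDeriv_contraction hX hη, map_add, wedgeCovector_contraction hp.self_of_nhds, smul_sub,
    LinearMap.coe_toContinuousLinearMap]
  abel

omit [FiniteDimensional ℝ E] in
/-- The contribution of one coordinate direction to `contraction_schoutenLocal`, for
`A = ∂ᵢX`, `B = Y`, `C = dxⁱ ⌟ X`, `D = ∂ᵢY`, `f = dxⁱ` and `ζ = ∂ᵢη`; the terms with `ζ` cancel. -/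
theorem contraction_schouten_summand {p q : ℤ} {A B C D : ExteriorAlgebra ℝ E}
    (hA : A ∈ multivectors E p) (hB : B ∈ multivectors E q) (hC : C ∈ multivectors E (p - 1))
    (hD : D ∈ multivectors E q) (f : E →L[ℝ] ℝ) (η ζ : Forms E) :
    (-1 : ℝ) ^ (p - 1) • contraction (C * D) η -
        contraction (A * CliffordAlgebra.contractLeft (f : E →ₗ[ℝ] ℝ) B) η =
      (-1 : ℝ) ^ ((p - 1) * q) • (wedgeCovector f (contraction A (contraction B η)) -
          (-1 : ℝ) ^ p • contraction C (contraction D η + contraction B ζ)) -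
        contraction B (wedgeCovector f (contraction A η) - (-1 : ℝ) ^ p • contraction C ζ) := by
  rw [contraction_comm_smul hA hB, map_smul, wedgeCovector_contraction hB, map_add,
    contraction_comm_smul hC hD, contraction_comm_smul hC hB, contraction_mul, contraction_mul,
    map_sub, map_smul]
  simp only [Module.End.mul_apply, neg_one_zpow_eq_ite, Int.even_mul, Int.even_sub,
    Int.not_even_one]
  by_cases hp : Even p <;> by_cases hq : Even q <;>
    simp only [hp, hq, iff_false, or_true, or_false, not_true, if_true, if_false, one_smul,
      Forms.neg_one_smul] <;>
    abel

/-- The Schouten bracket acts on forms as the graded commutator of Lie derivative and interior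
product: `ι_[X, Y] = (-1)^((p-1)q) ℒ_X ι_Y - ι_Y ℒ_X`. -/
theorem contraction_schoutenLocal {p q : ℤ} {X Y : E → ExteriorAlgebra ℝ E} {η : E → Forms E}
    {y : E} (hp : ∀ᶠ z in 𝓝 y, X z ∈ multivectors E p) (hX : DifferentiableAt ℝ X y)
    (hq : ∀ᶠ z in 𝓝 y, Y z ∈ multivectors E q) (hY : DifferentiableAt ℝ Y y)
    (hη : ∀ a, DifferentiableAt ℝ (fun z => η z a) y) :
    contraction (schoutenLocal p X Y y) (η y) =
      (-1 : ℝ) ^ ((p - 1) * q) •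
          (extDerivLocal (fun z => contraction (X z) (contraction (Y z) (η z))) y -
            (-1 : ℝ) ^ p • contraction (X y)
              (extDerivLocal (fun z => contraction (Y z) (η z)) y)) -
        contraction (Y y) (extDerivLocal (fun z => contraction (X z) (η z)) y -
          (-1 : ℝ) ^ p • contraction (X y) (extDerivLocal η y)) := by
  rw [lieLocal_eq_sum hp hX hη, lieLocal_eq_sum hp hX (differentiableAt_contraction hY hη),
    Finset.smul_sum, map_sum, ← Finset.sum_sub_distrib, schoutenLocal, Finset.smul_sum,
    ← Finset.sum_sub_distrib, map_sum, LinearMap.sum_apply]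
  refine Finset.sum_congr rfl fun i _ => ?_
  rw [dirDeriv_contraction hY hη, map_sub, map_smul]
  exact contraction_schouten_summand (fderiv_mem_submodule _ hX hp _) hq.self_of_nhds
    (contractLeft_mem_multivectors _ hp.self_of_nhds) (fderiv_mem_submodule _ hY hq _)
    (LinearMap.toContinuousLinearMap ((Module.finBasis ℝ E).coord i)) _ _

theorem schoutenLocal_mem_multivectors {p q : ℤ} {X Y : E → ExteriorAlgebra ℝ E} {y : E}
    (hp : ∀ᶠ z in 𝓝 y, X z ∈ multivectors E p) (hX : DifferentiableAt ℝ X y)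
    (hq : ∀ᶠ z in 𝓝 y, Y z ∈ multivectors E q) (hY : DifferentiableAt ℝ Y y) :
    schoutenLocal p X Y y ∈ multivectors E (p + q - 1) := by
  refine sub_mem (Submodule.smul_mem _ _ (sum_mem fun i _ => ?_)) (sum_mem fun i _ => ?_)
  · have h := mul_mem_multivectors
      (contractLeft_mem_multivectors ((Module.finBasis ℝ E).coord i) hp.self_of_nhds)
      (fderiv_mem_submodule _ hY hq (Module.finBasis ℝ E i))
    rwa [show p - 1 + q = p + q - 1 by ring] at h
  · have h := mul_mem_multivectors (fderiv_mem_submodule _ hX hp (Module.finBasis ℝ E i))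
      (contractLeft_mem_multivectors ((Module.finBasis ℝ E).coord i) hq.self_of_nhds)
    rwa [show p + (q - 1) = p + q - 1 by ring] at h

/-- Graded skew-symmetry of the Schouten bracket. -/
theorem schoutenLocal_skew {p q : ℤ} {X Y : E → ExteriorAlgebra ℝ E} {y : E}
    (hp : ∀ᶠ z in 𝓝 y, X z ∈ multivectors E p) (hX : DifferentiableAt ℝ X y)
    (hq : ∀ᶠ z in 𝓝 y, Y z ∈ multivectors E q) (hY : DifferentiableAt ℝ Y y) :
    schoutenLocal p X Y y = -((-1 : ℝ) ^ ((p - 1) * (q - 1)) • schoutenLocal q Y X y) := by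
  simp only [schoutenLocal, Finset.smul_sum, ← Finset.sum_sub_distrib, ← Finset.sum_neg_distrib]
  refine Finset.sum_congr rfl fun i _ => ?_
  rw [mul_comm_smul (contractLeft_mem_multivectors ((Module.finBasis ℝ E).coord i)
      hp.self_of_nhds) (fderiv_mem_submodule _ hY hq (Module.finBasis ℝ E i)),
    mul_comm_smul (contractLeft_mem_multivectors ((Module.finBasis ℝ E).coord i)
      hq.self_of_nhds) (fderiv_mem_submodule _ hX hp (Module.finBasis ℝ E i))]
  simp only [neg_one_zpow_eq_ite, Int.even_mul, Int.even_sub, Int.not_even_one]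
  by_cases hp : Even p <;> by_cases hq : Even q <;> 
    simp only [hp, hq, iff_false, or_true, or_false, not_true, if_true, if_false, one_smul,
      neg_smul] <;>
    abel

theorem contDiffOn_schoutenLocal {s : Set E} (hs : IsOpen s) (p : ℤ)
    {X Y : E → ExteriorAlgebra ℝ E} (hX : ContDiffOn ℝ ∞ X s) (hY : ContDiffOn ℝ ∞ Y s) :
    ContDiffOn ℝ ∞ (schoutenLocal p X Y) s := by
  have hmul : ∀ {f g : E → ExteriorAlgebra ℝ E}, ContDiffOn ℝ ∞ f s → ContDiffOn ℝ ∞ g s →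
      ContDiffOn ℝ ∞ (fun z => f z * g z) s := fun hf hg =>
    (LinearMap.toContinuousBilinearMap
      (LinearMap.mul ℝ (ExteriorAlgebra ℝ E))).isBoundedBilinearMap.contDiff.comp₂_contDiffOn hf hg
  have hcon : ∀ (f : Module.Dual ℝ E) {X : E → ExteriorAlgebra ℝ E}, ContDiffOn ℝ ∞ X s →
      ContDiffOn ℝ ∞ (fun z => CliffordAlgebra.contractLeft f (X z)) s := fun f X hX =>
    (LinearMap.toContinuousLinearMap (CliffordAlgebra.contractLeft (Q := (0 : QuadraticForm ℝ E))
      f : ExteriorAlgebra ℝ E →ₗ[ℝ] ExteriorAlgebra ℝ E)).contDiff.comp_contDiffOn hX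
  have hder : ∀ (v : E) {X : E → ExteriorAlgebra ℝ E}, ContDiffOn ℝ ∞ X s →
      ContDiffOn ℝ ∞ (fun z => fderiv ℝ X z v) s := fun v X hX =>
    (hX.fderiv_of_isOpen (m := ∞) hs (by simp)).clm_apply contDiffOn_const
  exact (ContDiffOn.const_smul _ (ContDiffOn.sum fun i _ => hmul (hcon _ hX) (hder _ hY))).sub
    (ContDiffOn.sum fun i _ => hmul (hder _ hX) (hcon _ hY))

/-- Naturality of the Schouten bracket. Tested against constant forms it follows, by faithfulness
of the interior product, from the naturality of the exterior derivative. -/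
theorem map_schoutenLocal {p q : ℤ} {ψ : E → E} {y : E} {B : E →L[ℝ] E}
    {X Y X' Y' : E → ExteriorAlgebra ℝ E}
    (hψ : ContDiffAt ℝ ∞ ψ y) (hB : (fderiv ℝ ψ y).comp B = ContinuousLinearMap.id ℝ E)
    (hp : ∀ᶠ z in 𝓝 y, X z ∈ multivectors E p) (hX : DifferentiableAt ℝ X y)
    (hq : ∀ᶠ z in 𝓝 y, Y z ∈ multivectors E q) (hY : DifferentiableAt ℝ Y y)
    (hp' : ∀ᶠ z in 𝓝 (ψ y), X' z ∈ multivectors E p) (hX' : DifferentiableAt ℝ X' (ψ y))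
    (hq' : ∀ᶠ z in 𝓝 (ψ y), Y' z ∈ multivectors E q) (hY' : DifferentiableAt ℝ Y' (ψ y))
    (hXX' : ∀ᶠ z in 𝓝 y, ExteriorAlgebra.map (fderiv ℝ ψ z).toLinearMap (X z) = X' (ψ z))
    (hYY' : ∀ᶠ z in 𝓝 y, ExteriorAlgebra.map (fderiv ℝ ψ z).toLinearMap (Y z) = Y' (ψ z)) :
    ExteriorAlgebra.map (fderiv ℝ ψ y).toLinearMap (schoutenLocal p X Y y) =
      schoutenLocal p X' Y' (ψ y) := by
  refine contraction_injective (LinearMap.ext fun θ => ?_)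
  have hinj : Function.LeftInverse (Forms.pullback B) (Forms.pullback (fderiv ℝ ψ y)) := by
    intro η
    funext a
    ext m
    rw [Forms.pullback_apply, Forms.pullback_apply]
    congr 1
    funext i
    exact congrArg (fun T : E →L[ℝ] E => T (m i)) hB
  apply hinj.injective
  have hθ : ∀ a, DifferentiableAt ℝ (fun _ : E => θ a) (ψ y) := fun a => differentiableAt_const _
  have hdψ : DifferentiableAt ℝ (fderiv ℝ ψ) y :=
    (hψ.fderiv_right (m := ∞) (by simp)).differentiableAt (by simp)
  have hη : ∀ a, DifferentiableAt ℝ (fun z => Forms.pullback (fderiv ℝ ψ z) θ a) y := fun a =>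
    (differentiableAt_const (θ a)).continuousAlternatingMapCompContinuousLinearMap hdψ
  have hpull : ∀ {Z : E → ExteriorAlgebra ℝ E} {Z' : E → ExteriorAlgebra ℝ E},
      (∀ᶠ z in 𝓝 y, ExteriorAlgebra.map (fderiv ℝ ψ z).toLinearMap (Z z) = Z' (ψ z)) →
      ∀ {η ζ : E → Forms E}, (∀ᶠ z in 𝓝 y, η z = Forms.pullback (fderiv ℝ ψ z) (ζ (ψ z))) →
        ∀ᶠ z in 𝓝 y, contraction (Z z) (η z) =
          Forms.pullback (fderiv ℝ ψ z) (contraction (Z' (ψ z)) (ζ (ψ z))) := by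
    intro Z Z' hZ η ζ h
    filter_upwards [hZ, h] with z h1 h2
    rw [← h1, pullback_contraction, h2]
  have h0 : ∀ᶠ z in 𝓝 y, Forms.pullback (fderiv ℝ ψ z) θ =
      Forms.pullback (fderiv ℝ ψ z) ((fun _ => θ) (ψ z)) := Eventually.of_forall fun _ => rfl
  have hY0 := hpull hYY' (ζ := fun _ => θ) h0
  have hX0 := hpull hXX' (ζ := fun _ => θ) h0
  have hXY := hpull hXX' (ζ := fun z => contraction (Y' z) θ) hY0
  have hdY := differentiableAt_contraction hY' hθ
  rw [pullback_contraction]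
  rw [contraction_schoutenLocal hp hX hq hY hη,
    contraction_schoutenLocal (η := fun _ => θ) hp' hX' hq' hY' hθ]
  simp only [map_sub, map_smul]
  rw [extDerivLocal_congr hXY, extDerivLocal_congr hY0, extDerivLocal_congr hX0]
  rw [extDerivLocal_pullback (ζ := fun z => contraction (X' z) (contraction (Y' z) θ)) hψ
      (differentiableAt_contraction hX' hdY),
    extDerivLocal_pullback (ζ := fun z => contraction (Y' z) θ) hψ hdY,
    extDerivLocal_pullback (ζ := fun z => contraction (X' z) θ) hψ
      (differentiableAt_contraction hX' hθ),
    extDerivLocal_pullback (ζ := fun _ => θ) hψ hθ]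
  simp only [← pullback_contraction, hXX'.self_of_nhds, hYY'.self_of_nhds]

end LocalSchouten

/-! ### Chart derivatives and coordinate expressions -/

section Charts

open Filter Topology

variable {E : Type*} [NormedAddCommGroup E] [NormedSpace ℝ E]
  {M : Type*} [TopologicalSpace M] [ChartedSpace E M]

section OneManifold

variable [IsManifold 𝓘(ℝ, E) 1 M]

theorem chartDeriv_isInvertible {x₀ x : M} (hx : x ∈ (extChartAt 𝓘(ℝ, E) x₀).source) :
    (chartDeriv (E := E) x₀ x).IsInvertible :=
  isInvertible_mfderiv_extChartAt hx

theorem chartSymmDeriv_eq_inverse {x₀ : M} {y : E} (hy : y ∈ (extChartAt 𝓘(ℝ, E) x₀).target) :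
    chartSymmDeriv x₀ y = (chartDeriv x₀ ((extChartAt 𝓘(ℝ, E) x₀).symm y)).inverse := by
  have h1 := mfderiv_extChartAt_comp_mfderivWithin_extChartAt_symm hy
  have h2 := mfderivWithin_extChartAt_symm_comp_mfderiv_extChartAt hy
  rw [ModelWithCorners.range_eq_univ, mfderivWithin_univ] at h1 h2
  exact (ContinuousLinearMap.inverse_eq h1 h2).symm

theorem FormField.inChart_eq (η : FormField E M) {x₀ : M} {y : E}
    (hy : y ∈ (extChartAt 𝓘(ℝ, E) x₀).target) :
    η.inChart x₀ y = Forms.pullback (chartDeriv x₀ ((extChartAt 𝓘(ℝ, E) x₀).symm y)).inverse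
      (η ((extChartAt 𝓘(ℝ, E) x₀).symm y)) := by
  rw [← chartSymmDeriv_eq_inverse hy]
  rfl

theorem FormField.inChart_apply (η : FormField E M) {x₀ x : M}
    (hx : x ∈ (extChartAt 𝓘(ℝ, E) x₀).source) :
    η.inChart x₀ (extChartAt 𝓘(ℝ, E) x₀ x) =
      Forms.pullback (chartDeriv x₀ x).inverse (η x) := by
  rw [η.inChart_eq ((extChartAt 𝓘(ℝ, E) x₀).map_source hx)]
  exact congrArg (fun x' => Forms.pullback (chartDeriv x₀ x').inverse (η x'))
    ((extChartAt 𝓘(ℝ, E) x₀).left_inv hx)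

omit [IsManifold 𝓘(ℝ, E) 1 M] in
theorem MultivectorField.inChart_apply (X : MultivectorField E M) {x₀ x : M}
    (hx : x ∈ (extChartAt 𝓘(ℝ, E) x₀).source) :
    X.inChart x₀ (extChartAt 𝓘(ℝ, E) x₀ x) =
      ExteriorAlgebra.map (chartDeriv x₀ x).toLinearMap (X x) :=
  congrArg (fun x' => ExteriorAlgebra.map (chartDeriv x₀ x').toLinearMap (X x'))
    ((extChartAt 𝓘(ℝ, E) x₀).left_inv hx)

theorem Forms.pullback_pullback {V W U : Type*} [AddCommGroup V] [Module ℝ V] [TopologicalSpace V]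
    [AddCommGroup W] [Module ℝ W] [TopologicalSpace W]
    [AddCommGroup U] [Module ℝ U] [TopologicalSpace U] (A : V →L[ℝ] W) (B : W →L[ℝ] U)
    (η : Forms U) : Forms.pullback A (Forms.pullback B η) = Forms.pullback (B.comp A) η := rfl

theorem Forms.pullback_id {V : Type*} [AddCommGroup V] [Module ℝ V] [TopologicalSpace V]
    (η : Forms V) : Forms.pullback (ContinuousLinearMap.id ℝ V) η = η := rfl

theorem map_map_apply {V W U : Type*} [AddCommGroup V] [Module ℝ V] [TopologicalSpace V]
    [AddCommGroup W] [Module ℝ W] [TopologicalSpace W]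
    [AddCommGroup U] [Module ℝ U] [TopologicalSpace U] (A : V →L[ℝ] W) (B : W →L[ℝ] U)
    (u : ExteriorAlgebra ℝ V) :
    ExteriorAlgebra.map B.toLinearMap (ExteriorAlgebra.map A.toLinearMap u) =
      ExteriorAlgebra.map (B.comp A).toLinearMap u :=
  AlgHom.congr_fun (ExteriorAlgebra.map_comp_map A.toLinearMap B.toLinearMap) u

theorem map_id_apply {V : Type*} [AddCommGroup V] [Module ℝ V] [TopologicalSpace V]
    (u : ExteriorAlgebra ℝ V) :
    ExteriorAlgebra.map (ContinuousLinearMap.id ℝ V).toLinearMap u = u :=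
  AlgHom.congr_fun ExteriorAlgebra.map_id u

/-- A form is determined by its coordinate expressions. -/
theorem FormField.ext_inChart {η ζ : FormField E M}
    (h : ∀ (x₀ : M), ∀ y ∈ (extChartAt 𝓘(ℝ, E) x₀).target, η.inChart x₀ y = ζ.inChart x₀ y) :
    η = ζ := by
  funext x
  have hx := mem_extChartAt_source (I := 𝓘(ℝ, E)) x
  have h1 := h x _ ((extChartAt 𝓘(ℝ, E) x).map_source hx)
  rw [η.inChart_apply hx, ζ.inChart_apply hx] at h1
  have h2 := congrArg (Forms.pullback (chartDeriv x x)) h1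
  rwa [Forms.pullback_pullback, Forms.pullback_pullback,
    (chartDeriv_isInvertible hx).inverse_comp_self, Forms.pullback_id, Forms.pullback_id] at h2

/-- The interior product in a chart is the interior product of the coordinate expressions. -/
theorem inChart_interiorField (X : MultivectorField E M) (η : FormField E M) {x₀ : M} {y : E}
    (hy : y ∈ (extChartAt 𝓘(ℝ, E) x₀).target) :
    (interiorField X η).inChart x₀ y = contraction (X.inChart x₀ y) (η.inChart x₀ y) := by
  rw [FormField.inChart_eq _ hy, FormField.inChart_eq _ hy, ← pullback_contraction,
    MultivectorField.inChart, map_map_apply,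
    (chartDeriv_isInvertible ((extChartAt 𝓘(ℝ, E) x₀).map_target hy)).inverse_comp_self,
    map_id_apply]
  rfl

/-- The change of charts from the chart around `c` to the chart around `x₀`; it is meaningful on
`overlap c x₀` only. -/
def transition (c x₀ : M) : E → E := extChartAt 𝓘(ℝ, E) x₀ ∘ (extChartAt 𝓘(ℝ, E) c).symm

/-- The domain of the change of charts. -/
def overlap (c x₀ : M) : Set E :=
  ((extChartAt 𝓘(ℝ, E) c).symm ≫ extChartAt 𝓘(ℝ, E) x₀).source

omit [IsManifold 𝓘(ℝ, E) 1 M] in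
theorem mem_overlap {c x₀ : M} {y : E} : y ∈ overlap c x₀ ↔
    y ∈ (extChartAt 𝓘(ℝ, E) c).target ∧
      (extChartAt 𝓘(ℝ, E) c).symm y ∈ (extChartAt 𝓘(ℝ, E) x₀).source := by
  simp [overlap, PartialEquiv.trans_source]

omit [IsManifold 𝓘(ℝ, E) 1 M] in
theorem isOpen_overlap (c x₀ : M) : IsOpen (overlap (E := E) c x₀) := by
  have : overlap (E := E) c x₀ = (extChartAt 𝓘(ℝ, E) c).target ∩
      (extChartAt 𝓘(ℝ, E) c).symm ⁻¹' (extChartAt 𝓘(ℝ, E) x₀).source := by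
    ext y; exact mem_overlap
  rw [this]
  exact (continuousOn_extChartAt_symm c).isOpen_inter_preimage (isOpen_extChartAt_target c)
    (isOpen_extChartAt_source x₀)

theorem fderiv_transition {c x₀ : M} {y : E} (hy : y ∈ overlap c x₀) :
    fderiv ℝ (transition c x₀) y = (chartDeriv x₀ ((extChartAt 𝓘(ℝ, E) c).symm y)).comp
      (chartDeriv c ((extChartAt 𝓘(ℝ, E) c).symm y)).inverse := by
  obtain ⟨h1, h2⟩ := mem_overlap.1 hy
  have hs := mdifferentiableWithinAt_extChartAt_symm h1
  rw [ModelWithCorners.range_eq_univ, mdifferentiableWithinAt_univ] at hs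
  rw [← chartSymmDeriv_eq_inverse h1, ← mfderiv_eq_fderiv]
  exact mfderiv_comp y (mdifferentiableAt_extChartAt (by rwa [extChartAt_source] at h2)) hs

/-- Coordinate expressions of a form in two charts differ by pull-back. -/
theorem inChart_transition (η : FormField E M) {c x₀ : M} {y : E} (hy : y ∈ overlap c x₀) :
    η.inChart c y = Forms.pullback (fderiv ℝ (transition c x₀) y)
      (η.inChart x₀ (transition c x₀ y)) := by
  obtain ⟨h1, h2⟩ := mem_overlap.1 hy
  rw [fderiv_transition hy, ← Forms.pullback_pullback, transition, Function.comp_apply,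
    FormField.inChart_apply _ h2, Forms.pullback_pullback _ (ContinuousLinearMap.inverse _),
    (chartDeriv_isInvertible h2).inverse_comp_self, Forms.pullback_id, FormField.inChart_eq _ h1]

/-- Coordinate expressions of a multivector field in two charts differ by push-forward. -/
theorem map_inChart_transition (X : MultivectorField E M) {c x₀ : M} {y : E}
    (hy : y ∈ overlap c x₀) :
    ExteriorAlgebra.map (fderiv ℝ (transition c x₀) y).toLinearMap (X.inChart c y) =
      X.inChart x₀ (transition c x₀ y) := by
  obtain ⟨h1, h2⟩ := mem_overlap.1 hy
  rw [fderiv_transition hy, ← map_map_apply, transition, Function.comp_apply,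
    MultivectorField.inChart_apply _ h2, MultivectorField.inChart,
    map_map_apply (chartDeriv _ _) (ContinuousLinearMap.inverse _),
    (chartDeriv_isInvertible ((extChartAt 𝓘(ℝ, E) c).map_target h1)).inverse_comp_self,
    map_id_apply]

end OneManifold

theorem contDiffAt_transition [IsManifold 𝓘(ℝ, E) ∞ M] {c x₀ : M} {y : E}
    (hy : y ∈ overlap c x₀) : ContDiffAt ℝ ∞ (transition c x₀) y := by
  have h := contDiffWithinAt_ext_coord_change (I := 𝓘(ℝ, E)) (n := ∞) x₀ c hy
  rwa [ModelWithCorners.range_eq_univ, contDiffWithinAt_univ] at h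

end Charts

/-! ### Smooth forms on a manifold -/

section Smooth

open Filter Topology

variable {E : Type*} [NormedAddCommGroup E] [NormedSpace ℝ E]
  {M : Type*} [TopologicalSpace M] [ChartedSpace E M]

/-- A form with smooth components, not necessarily homogeneous. -/
def IsSmoothForm (η : FormField E M) : Prop :=
  ∀ (x₀ : M) (a : ℕ),
    ContDiffOn ℝ ∞ (fun y => η.inChart x₀ y a) (extChartAt 𝓘(ℝ, E) x₀).target

theorem IsForm.isSmoothForm {k : ℤ} {η : FormField E M} (h : IsForm k η) : IsSmoothForm η :=
  h.smooth

theorem inChart_sub (η ζ : FormField E M) (x₀ : M) (y : E) :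
    (η - ζ).inChart x₀ y = η.inChart x₀ y - ζ.inChart x₀ y := rfl

theorem inChart_smul (c : ℝ) (η : FormField E M) (x₀ : M) (y : E) :
    (c • η).inChart x₀ y = c • η.inChart x₀ y := rfl

theorem IsSmoothForm.sub {η ζ : FormField E M} (hη : IsSmoothForm η) (hζ : IsSmoothForm ζ) :
    IsSmoothForm (η - ζ) := fun x₀ a => (hη x₀ a).sub (hζ x₀ a)

theorem IsSmoothForm.smul (c : ℝ) {η : FormField E M} (hη : IsSmoothForm η) :
    IsSmoothForm (c • η) := fun x₀ a => (hη x₀ a).const_smul c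

theorem IsSmoothForm.contDiffAt {η : FormField E M} (hη : IsSmoothForm η) {x₀ : M} {y : E}
    (hy : y ∈ (extChartAt 𝓘(ℝ, E) x₀).target) (a : ℕ) :
    ContDiffAt ℝ ∞ (fun z => η.inChart x₀ z a) y :=
  (hη x₀ a).contDiffAt ((isOpen_extChartAt_target x₀).mem_nhds hy)

theorem IsSmoothForm.differentiableAt {η : FormField E M} (hη : IsSmoothForm η) {x₀ : M} {y : E}
    (hy : y ∈ (extChartAt 𝓘(ℝ, E) x₀).target) (a : ℕ) :
    DifferentiableAt ℝ (fun z => η.inChart x₀ z a) y :=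
  (hη.contDiffAt hy a).differentiableAt (by simp)

section Multivectors

variable [FiniteDimensional ℝ E]

theorem IsMultivector.differentiableAt {p : ℤ} {X : MultivectorField E M}
    (hX : IsMultivector p X) {x₀ : M} {y : E} (hy : y ∈ (extChartAt 𝓘(ℝ, E) x₀).target) :
    DifferentiableAt ℝ (X.inChart x₀) y :=
  ((hX.smooth x₀).contDiffAt ((isOpen_extChartAt_target x₀).mem_nhds hy)).differentiableAt
    (by simp)

theorem IsMultivector.inChart_mem {p : ℤ} {X : MultivectorField E M}
    (hX : IsMultivector p X) (x₀ : M) (y : E) : X.inChart x₀ y ∈ multivectors E p :=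
  map_mem_multivectors _ (hX.homogeneous _)

theorem IsMultivector.sub {p : ℤ} {X Y : MultivectorField E M} (hX : IsMultivector p X)
    (hY : IsMultivector p Y) : IsMultivector p (X - Y) where
  homogeneous x := sub_mem (hX.homogeneous x) (hY.homogeneous x)
  smooth x₀ := by
    have h : MultivectorField.inChart (X - Y) x₀ = X.inChart x₀ - Y.inChart x₀ :=
      funext fun y => map_sub _ _ _
    rw [h]
    exact (hX.smooth x₀).sub (hY.smooth x₀)

theorem IsMultivector.smul {p : ℤ} (c : ℝ) {X : MultivectorField E M} (hX : IsMultivector p X) :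
    IsMultivector p (c • X) where
  homogeneous x := Submodule.smul_mem _ c (hX.homogeneous x)
  smooth x₀ := by
    have h : MultivectorField.inChart (c • X) x₀ = c • X.inChart x₀ :=
      funext fun y => map_smul (ExteriorAlgebra.map _) c _
    rw [h]
    exact (hX.smooth x₀).const_smul c

end Multivectors

end Smooth

/-! ### Exterior derivative, interior product and Schouten bracket on a manifold -/

section GlobalOperators

open Filter Topology

variable {E : Type*} [NormedAddCommGroup E] [NormedSpace ℝ E] [FiniteDimensional ℝ E]
  {M : Type*} [TopologicalSpace M] [ChartedSpace E M] [IsManifold 𝓘(ℝ, E) ∞ M]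

omit [FiniteDimensional ℝ E] [IsManifold 𝓘(ℝ, E) ∞ M] in
theorem chartPoint_mem_overlap {x₀ : M} {y : E} (hy : y ∈ (extChartAt 𝓘(ℝ, E) x₀).target) :
    y ∈ overlap x₀ ((extChartAt 𝓘(ℝ, E) x₀).symm y) :=
  mem_overlap.2 ⟨hy, mem_extChartAt_source _⟩

omit [FiniteDimensional ℝ E] in
/-- The exterior derivative may be computed in any chart. -/
theorem inChart_extD {η : FormField E M} (hη : IsSmoothForm η) {x₀ : M} {y : E}
    (hy : y ∈ (extChartAt 𝓘(ℝ, E) x₀).target) :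
    (extD η).inChart x₀ y = extDerivLocal (η.inChart x₀) y := by
  set x := (extChartAt 𝓘(ℝ, E) x₀).symm y with hx
  have hov : y ∈ overlap x₀ x := chartPoint_mem_overlap hy
  have hnhds : η.inChart x₀ =ᶠ[𝓝 y] fun z => Forms.pullback (fderiv ℝ (transition x₀ x) z)
      (η.inChart x (transition x₀ x z)) := by
    filter_upwards [(isOpen_overlap x₀ x).mem_nhds hov] with z hz
    exact inChart_transition η hz
  rw [extDerivLocal_congr hnhds, extDerivLocal_pullback (contDiffAt_transition hov)
    (fun a => hη.differentiableAt ((extChartAt 𝓘(ℝ, E) x).map_source (mem_overlap.1 hov).2) a),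
    fderiv_transition hov, FormField.inChart_eq _ hy]
  rfl

omit [FiniteDimensional ℝ E] in
theorem IsSmoothForm.extD {η : FormField E M} (hη : IsSmoothForm η) : IsSmoothForm (extD η) :=
  fun x₀ a => (contDiffOn_extDerivLocal (isOpen_extChartAt_target x₀) (hη x₀) a).congr
    fun _ hy => congrFun (inChart_extD hη hy) a

omit [FiniteDimensional ℝ E] in
theorem extD_extD {η : FormField E M} (hη : IsSmoothForm η) :
    GradedJacobi.extD (GradedJacobi.extD η) = 0 := by
  refine FormField.ext_inChart fun x₀ y hy => ?_
  rw [inChart_extD hη.extD hy, extDerivLocal_congr (ζ := extDerivLocal (η.inChart x₀)),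
    extDerivLocal_extDerivLocal fun a => hη.contDiffAt hy a]
  · rfl
  · filter_upwards [(isOpen_extChartAt_target x₀).mem_nhds hy] with z hz
    exact inChart_extD hη hz

omit [FiniteDimensional ℝ E] [IsManifold 𝓘(ℝ, E) ∞ M] in
theorem extD_smul (c : ℝ) (η : FormField E M) :
    GradedJacobi.extD (c • η) = c • GradedJacobi.extD η := by
  funext x a
  cases a with
  | zero => exact (smul_zero c).symm
  | succ a =>
    have h := extDeriv_fun_smul (x := extChartAt 𝓘(ℝ, E) x x) c (fun z => η.inChart x z a)
    exact congrArg (fun ζ => ContinuousAlternatingMap.compContinuousLinearMap ζ (chartDeriv x x)) h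

omit [FiniteDimensional ℝ E] [IsManifold 𝓘(ℝ, E) ∞ M] in
theorem extD_add {η ζ : FormField E M} (hη : IsSmoothForm η) (hζ : IsSmoothForm ζ) :
    GradedJacobi.extD (η + ζ) = GradedJacobi.extD η + GradedJacobi.extD ζ := by
  funext x a
  cases a with
  | zero => exact (add_zero _).symm
  | succ a =>
    have hx := mem_extChartAt_target (I := 𝓘(ℝ, E)) x
    have h := extDeriv_fun_add (hη.differentiableAt hx a) (hζ.differentiableAt hx a)
    exact congrArg (fun ζ => ContinuousAlternatingMap.compContinuousLinearMap ζ (chartDeriv x x)) h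

theorem IsMultivector.isSmoothForm_interiorField {p : ℤ} {X : MultivectorField E M}
    (hX : IsMultivector p X) {η : FormField E M} (hη : IsSmoothForm η) :
    IsSmoothForm (interiorField X η) := fun x₀ a =>
  (contDiffOn_contraction (hX.smooth x₀) (hη x₀) a).congr
    fun _ hy => congrFun (inChart_interiorField X η hy) a

theorem IsMultivector.isForm_interiorField {p k : ℤ} {X : MultivectorField E M}
    (hX : IsMultivector p X) {η : FormField E M} (hη : IsForm k η) :
    IsForm (k - p) (interiorField X η) where
  homogeneous x a ha := contraction_homogeneous (hX.homogeneous x) (hη.homogeneous x) a ha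
  smooth := hX.isSmoothForm_interiorField hη.isSmoothForm

theorem inChart_extD_interiorField {p : ℤ} {X : MultivectorField E M} (hX : IsMultivector p X)
    {η : FormField E M} (hη : IsSmoothForm η) {x₀ : M} {y : E}
    (hy : y ∈ (extChartAt 𝓘(ℝ, E) x₀).target) :
    (extD (interiorField X η)).inChart x₀ y =
      extDerivLocal (fun z => contraction (X.inChart x₀ z) (η.inChart x₀ z)) y := by
  rw [inChart_extD (hX.isSmoothForm_interiorField hη) hy]
  refine extDerivLocal_congr ?_
  filter_upwards [(isOpen_extChartAt_target x₀).mem_nhds hy] with z hz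
  exact inChart_interiorField X η hz

/-- The Schouten bracket may be computed in any chart. -/
theorem inChart_schouten {p q : ℤ} {X Y : MultivectorField E M} (hX : IsMultivector p X)
    (hY : IsMultivector q Y) {x₀ : M} {y : E} (hy : y ∈ (extChartAt 𝓘(ℝ, E) x₀).target) :
    (schouten p X Y).inChart x₀ y = schoutenLocal p (X.inChart x₀) (Y.inChart x₀) y := by
  obtain ⟨x, hx, rfl⟩ : ∃ x ∈ (extChartAt 𝓘(ℝ, E) x₀).source, extChartAt 𝓘(ℝ, E) x₀ x = y :=
    ⟨_, (extChartAt 𝓘(ℝ, E) x₀).map_target hy, (extChartAt 𝓘(ℝ, E) x₀).right_inv hy⟩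
  have hxt := mem_extChartAt_target (I := 𝓘(ℝ, E)) x
  have hsymm : (extChartAt 𝓘(ℝ, E) x).symm (extChartAt 𝓘(ℝ, E) x x) = x := extChartAt_to_inv x
  have hov : extChartAt 𝓘(ℝ, E) x x ∈ overlap x x₀ := mem_overlap.2 ⟨hxt, by rwa [hsymm]⟩
  have hψ : transition x x₀ (extChartAt 𝓘(ℝ, E) x x) = extChartAt 𝓘(ℝ, E) x₀ x :=
    congrArg (extChartAt 𝓘(ℝ, E) x₀) hsymm
  have hder : fderiv ℝ (transition x x₀) (extChartAt 𝓘(ℝ, E) x x) =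
      (chartDeriv x₀ x).comp (chartDeriv x x).inverse :=
    (fderiv_transition hov).trans
      (congrArg (fun x' => (chartDeriv x₀ x').comp (chartDeriv x x').inverse) hsymm)
  have hev : ∀ Z : MultivectorField E M, ∀ᶠ z in 𝓝 (extChartAt 𝓘(ℝ, E) x x),
      ExteriorAlgebra.map (fderiv ℝ (transition x x₀) z).toLinearMap (Z.inChart x z) =
        Z.inChart x₀ (transition x x₀ z) := fun Z => by
    filter_upwards [(isOpen_overlap x x₀).mem_nhds hov] with z hz
    exact map_inChart_transition Z hz
  have hinv : (fderiv ℝ (transition x x₀) (extChartAt 𝓘(ℝ, E) x x)).comp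
      ((chartDeriv x x).comp (chartDeriv x₀ x).inverse) = ContinuousLinearMap.id ℝ E := by
    rw [hder, ContinuousLinearMap.comp_assoc, ← ContinuousLinearMap.comp_assoc _ (chartDeriv x x),
      (chartDeriv_isInvertible (mem_extChartAt_source x)).inverse_comp_self,
      ContinuousLinearMap.id_comp, (chartDeriv_isInvertible hx).self_comp_inverse]
  have key := map_schoutenLocal (contDiffAt_transition hov) hinv
    (Eventually.of_forall (hX.inChart_mem x)) (hX.differentiableAt hxt)
    (Eventually.of_forall (hY.inChart_mem x)) (hY.differentiableAt hxt)
    (Eventually.of_forall (hX.inChart_mem x₀)) (hX.differentiableAt (hψ ▸ hy))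
    (Eventually.of_forall (hY.inChart_mem x₀)) (hY.differentiableAt (hψ ▸ hy)) (hev X) (hev Y)
  rw [hψ, hder, ← map_map_apply] at key
  rw [MultivectorField.inChart_apply _ hx, ← key]
  rfl

theorem IsMultivector.schouten {p q : ℤ} {X Y : MultivectorField E M} (hX : IsMultivector p X)
    (hY : IsMultivector q Y) : IsMultivector (p + q - 1) (schouten p X Y) where
  homogeneous x := map_mem_multivectors _ (schoutenLocal_mem_multivectors
    (Eventually.of_forall (hX.inChart_mem x)) (hX.differentiableAt (mem_extChartAt_target x))
    (Eventually.of_forall (hY.inChart_mem x)) (hY.differentiableAt (mem_extChartAt_target x)))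
  smooth x₀ := (contDiffOn_schoutenLocal (isOpen_extChartAt_target x₀) p (hX.smooth x₀)
    (hY.smooth x₀)).congr fun _ hy => inChart_schouten hX hY hy

omit [IsManifold 𝓘(ℝ, E) ∞ M] in
theorem schouten_skew {p q : ℤ} {X Y : MultivectorField E M} (hX : IsMultivector p X)
    (hY : IsMultivector q Y) : GradedJacobi.schouten p X Y =
      -((-1 : ℝ) ^ ((p - 1) * (q - 1)) • GradedJacobi.schouten q Y X) := by
  funext x
  have h := schoutenLocal_skew
    (Eventually.of_forall (hX.inChart_mem x)) (hX.differentiableAt (mem_extChartAt_target x))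
    (Eventually.of_forall (hY.inChart_mem x)) (hY.differentiableAt (mem_extChartAt_target x))
  rw [GradedJacobi.schouten, h, map_neg, map_smul]
  rfl

theorem inChart_lieD {p : ℤ} {X : MultivectorField E M} (hX : IsMultivector p X)
    {η : FormField E M} (hη : IsSmoothForm η) {x₀ : M} {y : E}
    (hy : y ∈ (extChartAt 𝓘(ℝ, E) x₀).target) :
    (lieD p X η).inChart x₀ y =
      extDerivLocal (fun z => contraction (X.inChart x₀ z) (η.inChart x₀ z)) y -
        (-1 : ℝ) ^ p • contraction (X.inChart x₀ y) (extDerivLocal (η.inChart x₀) y) := by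
  rw [lieD, inChart_sub, inChart_smul, inChart_extD_interiorField hX hη hy,
    inChart_interiorField _ _ hy, inChart_extD hη hy]

theorem IsMultivector.isSmoothForm_lieD {p : ℤ} {X : MultivectorField E M}
    (hX : IsMultivector p X) {η : FormField E M} (hη : IsSmoothForm η) :
    IsSmoothForm (lieD p X η) :=
  (hX.isSmoothForm_interiorField hη).extD.sub ((hX.isSmoothForm_interiorField hη.extD).smul _)

/-- The interior product with a Schouten bracket:
`ι_[X, Y] = (-1)^((p-1)q) ℒ_X ι_Y - ι_Y ℒ_X`. -/
theorem interiorField_schouten {p q : ℤ} {X Y : MultivectorField E M} (hX : IsMultivector p X)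
    (hY : IsMultivector q Y) {η : FormField E M} (hη : IsSmoothForm η) :
    interiorField (schouten p X Y) η =
      (-1 : ℝ) ^ ((p - 1) * q) • lieD p X (interiorField Y η) -
        interiorField Y (lieD p X η) := by
  refine FormField.ext_inChart fun x₀ y hy => ?_
  have hYη := hY.isSmoothForm_interiorField hη
  have hcongr : (interiorField Y η).inChart x₀ =ᶠ[𝓝 y]
      fun z => contraction (Y.inChart x₀ z) (η.inChart x₀ z) := by
    filter_upwards [(isOpen_extChartAt_target x₀).mem_nhds hy] with z hz
    exact inChart_interiorField Y η hz
  have hcongr' : (fun z => contraction (X.inChart x₀ z) ((interiorField Y η).inChart x₀ z)) =ᶠ[𝓝 y]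
      fun z => contraction (X.inChart x₀ z) (contraction (Y.inChart x₀ z) (η.inChart x₀ z)) :=
    hcongr.mono fun z hz => congrArg (contraction (X.inChart x₀ z)) hz
  rw [inChart_sub, inChart_smul, inChart_lieD hX hYη hy, inChart_interiorField _ _ hy,
    inChart_interiorField _ _ hy, inChart_lieD hX hη hy, inChart_schouten hX hY hy,
    extDerivLocal_congr hcongr, extDerivLocal_congr hcongr']
  exact contraction_schoutenLocal (Eventually.of_forall (hX.inChart_mem x₀))
    (hX.differentiableAt hy) (Eventually.of_forall (hY.inChart_mem x₀)) (hY.differentiableAt hy)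
    (hη.differentiableAt hy)

end GlobalOperators

/-! ### Graded commutation relations of the Cartan calculus -/

section Cartan

variable {E : Type*} [NormedAddCommGroup E] [NormedSpace ℝ E]
  {M : Type*} [TopologicalSpace M] [ChartedSpace E M]

theorem FormField.neg_one_smul (η : FormField E M) : (-1 : ℝ) • η = -η :=
  funext fun x => Forms.neg_one_smul (η x)

theorem interiorField_smul_sub (X : MultivectorField E M) (c : ℝ) (η ζ : FormField E M) :
    interiorField X (c • η - ζ) = c • interiorField X η - interiorField X ζ :=
  funext fun x => by
    change contraction (X x) (c • η x - ζ x) = c • contraction (X x) (η x) - contraction (X x) (ζ x)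
    rw [map_sub, map_smul]

theorem interiorField_smul (X : MultivectorField E M) (c : ℝ) (η : FormField E M) :
    interiorField X (c • η) = c • interiorField X η :=
  funext fun x => map_smul (contraction (X x)) c (η x)

theorem interiorField_neg (X : MultivectorField E M) (η : FormField E M) :
    interiorField X (-η) = -interiorField X η := by
  rw [← FormField.neg_one_smul, interiorField_smul, FormField.neg_one_smul]

theorem interiorField_neg_smul_left (c : ℝ) (X : MultivectorField E M) (η : FormField E M) :
    interiorField (-(c • X)) η = -(c • interiorField X η) :=
  funext fun x => by
    change contraction (-(c • X x)) (η x) = -(c • contraction (X x) (η x))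
    rw [map_neg, map_smul]
    rfl

theorem interiorField_sub_smul_left (X : MultivectorField E M) (c : ℝ) (Y : MultivectorField E M)
    (η : FormField E M) :
    interiorField (X - c • Y) η = interiorField X η - c • interiorField Y η :=
  funext fun x => by
    change contraction (X x - c • Y x) (η x) =
      contraction (X x) (η x) - c • contraction (Y x) (η x)
    rw [map_sub, map_smul]
    rfl

theorem extD_smul_sub {η ζ : FormField E M} (hη : IsSmoothForm η) (hζ : IsSmoothForm ζ) (c : ℝ) :
    extD (c • η - ζ) = c • extD η - extD ζ := by
  have h : c • η - ζ = c • η + (-1 : ℝ) • ζ := by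
    rw [FormField.neg_one_smul, sub_eq_add_neg]
  rw [h, extD_add (hη.smul c) (hζ.smul _), extD_smul, extD_smul, FormField.neg_one_smul,
    ← sub_eq_add_neg]

variable [FiniteDimensional ℝ E]

/-- Graded commutativity of interior products. -/
theorem interiorField_comm {p q : ℤ} {X Y : MultivectorField E M} (hX : IsMultivector p X)
    (hY : IsMultivector q Y) (η : FormField E M) :
    interiorField X (interiorField Y η) =
      (-1 : ℝ) ^ (p * q) • interiorField Y (interiorField X η) :=
  funext fun x => contraction_comm_smul (hX.homogeneous x) (hY.homogeneous x) (η x)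

omit [FiniteDimensional ℝ E] in
theorem lieD_smul (p : ℤ) (X : MultivectorField E M) (c : ℝ) (η : FormField E M) :
    lieD p X (c • η) = c • lieD p X η := by
  simp only [lieD, interiorField_smul, extD_smul, smul_sub, smul_comm c]

variable [IsManifold 𝓘(ℝ, E) ∞ M]

theorem lieD_smul_sub {p : ℤ} {X : MultivectorField E M} (hX : IsMultivector p X)
    {η ζ : FormField E M} (hη : IsSmoothForm η) (hζ : IsSmoothForm ζ) (c : ℝ) :
    lieD p X (c • η - ζ) = c • lieD p X η - lieD p X ζ := by
  rw [lieD, lieD, lieD, interiorField_smul_sub, extD_smul_sub hη hζ, interiorField_smul_sub,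
    extD_smul_sub (hX.isSmoothForm_interiorField hη) (hX.isSmoothForm_interiorField hζ)]
  simp only [smul_sub, smul_comm c]
  abel

/-- The exterior derivative commutes with Lie derivatives in the graded sense. -/
theorem extD_lieD {p : ℤ} {X : MultivectorField E M} (hX : IsMultivector p X)
    {η : FormField E M} (hη : IsSmoothForm η) :
    extD (lieD p X η) = -((-1 : ℝ) ^ p • lieD p X (extD η)) := by
  have hXη := hX.isSmoothForm_interiorField hη
  have hXdη := hX.isSmoothForm_interiorField hη.extD
  have h1 : interiorField X (0 : FormField E M) = 0 := funext fun x => map_zero _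
  have h2 : lieD p X (extD η) = extD (interiorField X (extD η)) := by
    rw [lieD, extD_extD hη, h1, smul_zero, sub_zero]
  have h3 : lieD p X η = (1 : ℝ) • extD (interiorField X η) -
      (-1 : ℝ) ^ p • interiorField X (extD η) := by rw [one_smul]; rfl
  rw [h2, h3, extD_smul_sub hXη.extD (hXdη.smul _), extD_extD hXη, extD_smul, smul_zero, zero_sub]

/-- The Lie derivative along a Schouten bracket:
`ℒ_[X, Y] = (-1)^((p-1)(q-1)) ℒ_X ℒ_Y - ℒ_Y ℒ_X`. -/
theorem lieD_schouten {p q : ℤ} {X Y : MultivectorField E M} (hX : IsMultivector p X)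
    (hY : IsMultivector q Y) {η : FormField E M} (hη : IsSmoothForm η) :
    lieD (p + q - 1) (schouten p X Y) η =
      (-1 : ℝ) ^ ((p - 1) * (q - 1)) • lieD p X (lieD q Y η) - lieD q Y (lieD p X η) := by
  have hYη := hY.isSmoothForm_interiorField hη
  have hYdη := hY.isSmoothForm_interiorField hη.extD
  have hXη := hX.isSmoothForm_lieD hη
  have hLY : lieD q Y η = (1 : ℝ) • extD (interiorField Y η) -
      (-1 : ℝ) ^ q • interiorField Y (extD η) := by rw [one_smul]; rfl
  have hL : lieD (p + q - 1) (schouten p X Y) η = extD (interiorField (schouten p X Y) η) -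
      (-1 : ℝ) ^ (p + q - 1) • interiorField (schouten p X Y) (extD η) := rfl
  have hLL : lieD q Y (lieD p X η) = extD (interiorField Y (lieD p X η)) -
      (-1 : ℝ) ^ q • interiorField Y (extD (lieD p X η)) := rfl
  rw [hL, hLL, hLY, lieD_smul_sub hX hYη.extD (hYdη.smul _), lieD_smul,
    interiorField_schouten hX hY hη, interiorField_schouten hX hY hη.extD,
    extD_smul_sub (hX.isSmoothForm_lieD hYη) (hY.isSmoothForm_interiorField hXη),
    extD_lieD hX hYη, extD_lieD hX hη, interiorField_neg, interiorField_smul]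
  generalize lieD p X (extD (interiorField Y η)) = A
  generalize lieD p X (interiorField Y (extD η)) = B
  generalize extD (interiorField Y (lieD p X η)) = C
  generalize interiorField Y (lieD p X (extD η)) = D
  simp only [neg_one_zpow_eq_ite, Int.even_mul, Int.even_sub, Int.even_add, Int.not_even_one]
  by_cases hp : Even p <;> by_cases hq : Even q <;>
    simp only [hp, hq, iff_false, iff_true, or_true, or_false, not_true, if_true,
      if_false, one_smul, FormField.neg_one_smul] <;>
    abel

/-- The graded Jacobi identity for the Schouten bracket, contracted into a form. -/
theorem interiorField_schouten_jacobi {p q r : ℤ} {X Y Z : MultivectorField E M}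
    (hX : IsMultivector p X) (hY : IsMultivector q Y) (hZ : IsMultivector r Z)
    {η : FormField E M} (hη : IsSmoothForm η) :
    (-1 : ℝ) ^ ((p - 1) * (r - 1)) • interiorField (schouten p X (schouten q Y Z)) η +
        (-1 : ℝ) ^ ((r - 1) * (q - 1)) • interiorField (schouten r Z (schouten p X Y)) η +
        (-1 : ℝ) ^ ((q - 1) * (p - 1)) • interiorField (schouten q Y (schouten r Z X)) η = 0 := by
  have hZη := hZ.isSmoothForm_interiorField hη
  have hXη := hX.isSmoothForm_lieD hη
  have hYη := hY.isSmoothForm_lieD hη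
  have h1 : interiorField (schouten p X (schouten q Y Z)) η =
      (-1 : ℝ) ^ ((p - 1) * (q + r - 1)) •
        ((-1 : ℝ) ^ ((q - 1) * r) • lieD p X (lieD q Y (interiorField Z η)) -
          lieD p X (interiorField Z (lieD q Y η))) -
      ((-1 : ℝ) ^ ((q - 1) * r) • lieD q Y (interiorField Z (lieD p X η)) -
        interiorField Z (lieD q Y (lieD p X η))) := by
    rw [interiorField_schouten hX (hY.schouten hZ) hη, interiorField_schouten hY hZ hη,
      interiorField_schouten hY hZ hXη, lieD_smul_sub hX (hY.isSmoothForm_lieD hZη)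
        (hZ.isSmoothForm_interiorField hYη)]
  have h2 : interiorField (schouten r Z (schouten p X Y)) η =
      -((-1 : ℝ) ^ ((r - 1) * (p + q - 1 - 1)) •
        ((-1 : ℝ) ^ ((p + q - 1 - 1) * r) •
          ((-1 : ℝ) ^ ((p - 1) * (q - 1)) • lieD p X (lieD q Y (interiorField Z η)) -
            lieD q Y (lieD p X (interiorField Z η))) -
        ((-1 : ℝ) ^ ((p - 1) * (q - 1)) • interiorField Z (lieD p X (lieD q Y η)) -
          interiorField Z (lieD q Y (lieD p X η))))) := by
    rw [schouten_skew hZ (hX.schouten hY), interiorField_neg_smul_left,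
      interiorField_schouten (hX.schouten hY) hZ hη, lieD_schouten hX hY hη,
      lieD_schouten hX hY hZη, interiorField_smul_sub]
  -- With `[Z, X]` rewritten through `[X, Z]`, all terms are words in `ℒ_X`, `ℒ_Y` and `ι_Z`.
  have h3' : ∀ {ζ : FormField E M}, IsSmoothForm ζ → interiorField (schouten r Z X) ζ =
      -((-1 : ℝ) ^ ((r - 1) * (p - 1)) • ((-1 : ℝ) ^ ((p - 1) * r) • lieD p X (interiorField Z ζ) -
        interiorField Z (lieD p X ζ))) := fun hζ => by
    rw [schouten_skew hZ hX, interiorField_neg_smul_left, interiorField_schouten hX hZ hζ]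
  have h3 : interiorField (schouten q Y (schouten r Z X)) η =
      (-1 : ℝ) ^ ((q - 1) * (r + p - 1)) •
        -((-1 : ℝ) ^ ((r - 1) * (p - 1)) •
          ((-1 : ℝ) ^ ((p - 1) * r) • lieD q Y (lieD p X (interiorField Z η)) -
            lieD q Y (interiorField Z (lieD p X η)))) -
      -((-1 : ℝ) ^ ((r - 1) * (p - 1)) •
        ((-1 : ℝ) ^ ((p - 1) * r) • lieD p X (interiorField Z (lieD q Y η)) -
          interiorField Z (lieD p X (lieD q Y η)))) := by
    rw [interiorField_schouten hY (hZ.schouten hX) hη, h3' hη, h3' hYη,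
      ← FormField.neg_one_smul ((-1 : ℝ) ^ ((r - 1) * (p - 1)) • (_ • lieD p X _ - _)),
      lieD_smul, lieD_smul, lieD_smul_sub hY (hX.isSmoothForm_lieD hZη)
        (hZ.isSmoothForm_interiorField hXη), FormField.neg_one_smul]
  rw [h1, h2, h3]
  generalize lieD p X (lieD q Y (interiorField Z η)) = A
  generalize lieD q Y (lieD p X (interiorField Z η)) = A'
  generalize interiorField Z (lieD p X (lieD q Y η)) = B
  generalize interiorField Z (lieD q Y (lieD p X η)) = B'
  generalize lieD p X (interiorField Z (lieD q Y η)) = C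
  generalize lieD q Y (interiorField Z (lieD p X η)) = C'
  simp only [neg_one_zpow_eq_ite, Int.even_mul, Int.even_sub, Int.even_add, Int.not_even_one]
  by_cases hp : Even p <;> by_cases hq : Even q <;> by_cases hr : Even r <;>
    simp only [hp, hq, hr, iff_false, iff_true, or_true, or_false, not_true,
      if_true, if_false, one_smul, FormField.neg_one_smul] <;>
    abel

end Cartan

/-! ### The graded Jacobi bracket -/

section Bracket

variable {E : Type*} [NormedAddCommGroup E] [NormedSpace ℝ E] [FiniteDimensional ℝ E]
  {M : Type*} [TopologicalSpace M] [ChartedSpace E M] [IsManifold 𝓘(ℝ, E) ∞ M]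

/-- Infinitesimal conformal transformations are closed under the Schouten bracket: if
`ℒ_X Θ = ι_V Θ` and `ℒ_Y Θ = ι_W Θ`, then `ℒ_[X, Y] Θ = ι_U Θ` for
`U = [X, W] - (-1)^((p-1)(q-1)) [Y, V]`. -/
theorem IsConformalTransformation.schouten {Θ : FormField E M} (hΘ : IsSmoothForm Θ) {p q : ℤ}
    {X Y : MultivectorField E M} (hX : IsConformalTransformation Θ p X)
    (hY : IsConformalTransformation Θ q Y) :
    IsConformalTransformation Θ (p + q - 1) (schouten p X Y) := by
  obtain ⟨hX, V, hV, hXV⟩ := hX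
  obtain ⟨hY, W, hW, hYW⟩ := hY
  refine ⟨hX.schouten hY, GradedJacobi.schouten p X W -
    (-1 : ℝ) ^ ((p - 1) * (q - 1)) • GradedJacobi.schouten q Y V, ?_, ?_⟩
  · have h1 := hX.schouten hW
    have h2 := hY.schouten hV
    rw [show p + (q - 1) - 1 = p + q - 1 - 1 by ring] at h1
    rw [show q + (p - 1) - 1 = p + q - 1 - 1 by ring] at h2
    exact h1.sub (h2.smul _)
  · rw [lieD_schouten hX hY hΘ, hXV, hYW, interiorField_sub_smul_left,
      interiorField_schouten hX hW hΘ, interiorField_schouten hY hV hΘ, hXV, hYW,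
      interiorField_comm hV hW, mul_comm (q - 1) (p - 1), neg_one_zpow_eq_ite]
    split_ifs <;> simp only [one_smul, FormField.neg_one_smul] <;> abel

/-- For a conformal transformation `X` the form `ι_[X, Y] Θ` depends on `Y` only through `ι_Y Θ`. -/
theorem interiorField_schouten_eq_of_lieD_eq {Θ : FormField E M} (hΘ : IsSmoothForm Θ) {p q : ℤ}
    {X Y V : MultivectorField E M} (hX : IsMultivector p X) (hY : IsMultivector q Y)
    (hV : IsMultivector (p - 1) V) (hXV : lieD p X Θ = interiorField V Θ) :
    interiorField (schouten p X Y) Θ = (-1 : ℝ) ^ ((p - 1) * q) • lieD p X (interiorField Y Θ) -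
      (-1 : ℝ) ^ ((p - 1) * q) • interiorField V (interiorField Y Θ) := by
  rw [interiorField_schouten hX hY hΘ, hXV, interiorField_comm hY hV, mul_comm q]

theorem interiorField_schouten_congr_right {Θ : FormField E M} (hΘ : IsSmoothForm Θ) {p q : ℤ}
    {X Y Y' : MultivectorField E M} (hX : IsConformalTransformation Θ p X)
    (hY : IsMultivector q Y) (hY' : IsMultivector q Y')
    (h : interiorField Y Θ = interiorField Y' Θ) :
    interiorField (schouten p X Y) Θ = interiorField (schouten p X Y') Θ := by
  obtain ⟨hX, V, hV, hXV⟩ := hX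
  rw [interiorField_schouten_eq_of_lieD_eq hΘ hX hY hV hXV,
    interiorField_schouten_eq_of_lieD_eq hΘ hX hY' hV hXV, h]

theorem interiorField_schouten_congr {Θ : FormField E M} (hΘ : IsSmoothForm Θ) {p q : ℤ}
    {X X' Y Y' : MultivectorField E M} (hX : IsConformalTransformation Θ p X)
    (hX' : IsConformalTransformation Θ p X') (hY : IsConformalTransformation Θ q Y)
    (hY' : IsConformalTransformation Θ q Y') (hXX' : interiorField X Θ = interiorField X' Θ)
    (hYY' : interiorField Y Θ = interiorField Y' Θ) :
    interiorField (schouten p X Y) Θ = interiorField (schouten p X' Y') Θ := by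
  rw [interiorField_schouten_congr_right hΘ hX hY.1 hY'.1 hYY', schouten_skew hX.1 hY'.1,
    schouten_skew hX'.1 hY'.1, interiorField_neg_smul_left, interiorField_neg_smul_left,
    interiorField_schouten_congr_right hΘ hY' hX.1 hX'.1 hXX']

/-- The graded Jacobi bracket may be computed from any conformal transformations that represent
the two forms. -/
theorem jacobiBracket_eq {Θ : FormField E M} (hΘ : IsSmoothForm Θ) {p q : ℤ}
    {α β : FormField E M} {X Y : MultivectorField E M}
    (hX : IsConformalTransformationFor Θ p α X) (hY : IsConformalTransformationFor Θ q β Y) :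
    jacobiBracket Θ p q α β = -interiorField (schouten p X Y) Θ := by
  have h : (∃ X, IsConformalTransformationFor Θ p α X) ∧
      (∃ Y, IsConformalTransformationFor Θ q β Y) := ⟨⟨X, hX⟩, ⟨Y, hY⟩⟩
  rw [jacobiBracket, dif_pos h, interiorField_schouten_congr hΘ h.1.choose_spec.1 hX.1
    h.2.choose_spec.1 hY.1 (h.1.choose_spec.2.trans hX.2.symm)
    (h.2.choose_spec.2.trans hY.2.symm)]

theorem IsConformalTransformationFor.schouten {Θ : FormField E M} (hΘ : IsSmoothForm Θ) {p q : ℤ}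
    {α β : FormField E M} {X Y : MultivectorField E M}
    (hX : IsConformalTransformationFor Θ p α X) (hY : IsConformalTransformationFor Θ q β Y) :
    IsConformalTransformationFor Θ (p + q - 1) (jacobiBracket Θ p q α β) (schouten p X Y) :=
  ⟨hX.1.schouten hΘ hY.1, by rw [jacobiBracket_eq hΘ hX hY, neg_neg]⟩

omit [FiniteDimensional ℝ E] [IsManifold 𝓘(ℝ, E) ∞ M] in
theorem IsForm.neg {k : ℤ} {η : FormField E M} (h : IsForm k η) : IsForm k (-η) where
  homogeneous x a ha := neg_eq_zero.2 (h.homogeneous x a ha)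
  smooth x₀ a := (h.smooth x₀ a).neg

end Bracket

end GradedJacobi
end

open GradedJacobi
theorem mainTheorem2
    {E : Type*} [NormedAddCommGroup E] [NormedSpace ℝ E] [FiniteDimensional ℝ E]
    {M : Type*} [TopologicalSpace M] [T2Space M] [SecondCountableTopology M]
    [ChartedSpace E M] [IsManifold 𝓘(ℝ, E) ∞ M]
    (n : ℕ) (Θ : FormField E M) (hΘ : IsForm n Θ)
    (p q r : ℤ) (α β γ : FormField E M)
    (hα : IsConformalHamiltonian n Θ p α)
    (hβ : IsConformalHamiltonian n Θ q β)
    (hγ : IsConformalHamiltonian n Θ r γ) :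
    (∀ X Y : MultivectorField E M,
        IsConformalTransformationFor Θ p α X → IsConformalTransformationFor Θ q β Y →
          jacobiBracket Θ p q α β = -interiorField (schouten p X Y) Θ) ∧
    IsConformalHamiltonian n Θ (p + q - 1) (jacobiBracket Θ p q α β) ∧
    jacobiBracket Θ p q α β =
      -((-1 : ℝ) ^ ((p - 1) * (q - 1)) • jacobiBracket Θ q p β α) ∧
    (-1 : ℝ) ^ ((p - 1) * (r - 1)) •
          jacobiBracket Θ p (q + r - 1) α (jacobiBracket Θ q r β γ) +
        (-1 : ℝ) ^ ((r - 1) * (q - 1)) •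
          jacobiBracket Θ r (p + q - 1) γ (jacobiBracket Θ p q α β) +
        (-1 : ℝ) ^ ((q - 1) * (p - 1)) •
          jacobiBracket Θ q (r + p - 1) β (jacobiBracket Θ r p γ α) = 0 := by
  obtain ⟨-, X, hX⟩ := hα
  obtain ⟨-, Y, hY⟩ := hβ
  obtain ⟨-, Z, hZ⟩ := hγ
  have hs := hΘ.isSmoothForm
  have hXY := hX.schouten hs hY
  refine ⟨fun X Y hX hY => jacobiBracket_eq hs hX hY, ⟨?_, _, hXY⟩, ?_, ?_⟩
  · rw [jacobiBracket_eq hs hX hY]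
    exact (hXY.1.1.isForm_interiorField hΘ).neg
  · rw [jacobiBracket_eq hs hX hY, jacobiBracket_eq hs hY hX, schouten_skew hX.1.1 hY.1.1,
      interiorField_neg_smul_left, smul_neg]
  · rw [jacobiBracket_eq hs hX (hY.schouten hs hZ), jacobiBracket_eq hs hZ hXY,
      jacobiBracket_eq hs hY (hZ.schouten hs hX)]
    simp only [smul_neg]
    rw [← neg_add, ← neg_add, interiorField_schouten_jacobi hX.1.1 hY.1.1 hZ.1.1 hs, neg_zero]
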